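/- Let $N\ge 2$ and let $F_N=F(A)$ be the free group with free basis $A=\{a_1,\dots,a_N\}$. For $g\in F_N$ let $[g]$ be its conjugacy class and $\|g\|_A=\|[g]\|_A$ its cyclically reduced length with respect to $A$; the group $\mathrm{Out}(F_N)$ acts on conjugacy classes by $\varphi([g])=[\Phi(g)]$, where $\Phi\in\mathrm{Aut}(F_N)$ is any representative of $\varphi$. Let $M\ge 1$ be an integer, $\lambda>1$ and $0\le\varepsilon<\lambda-1$. A finite set $S$ of conjugacy classes of nontrivial elements of $F_N$ is called $(M,\lambda,\varepsilon)$-minimizing if: (1) $\#S\le M$; (2) any two elements of $S$ lie in the same $\mathrm{Out}(F_N)$-orbit; (3) $1-\varepsilon\le \|u'\|_A/\|u\|_A\le 1+\varepsilon$ for all $[u],[u']\in S$; (4) for every $[u]\in S$ and every $\varphi\in\mathrm{Out}(F_N)$ with $\varphi([u])\notin S$ we have $\|\varphi(u)\|_A/\|u\|_A\ge\lambda$. A conjugacy class is called $(M,\lambda,\varepsilon)$-minimal if it belongs to some $(M,\lambda,\varepsilon)$-minimizing set. Then for all integers $N\ge 2$ and $M\ge 1$ there is a constant $K(N,M)$,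 depending only on $N$ and $M$, with the following property. For all $\lambda>1$ and $0\le\varepsilon<\lambda-1$, and for every $1\ne u\in F_N$ such that the orbit $\mathrm{Out}(F_N)[u]$ contains an $(M,\lambda,\varepsilon)$-minimal element, the stabilizer $\mathrm{Stab}_{\mathrm{Out}(F_N)}([u])$ is finitely generated and $$\operatorname{rank}\,\mathrm{Stab}_{\mathrm{Out}(F_N)}([u])\le K(N,M),$$ where the rank of a group is the smallest cardinality of a generating set. -/

import Mathlib

/-- Inner automorphisms form a normal subgroup of the automorphism group. -/
instance innerAutomorphisms_normal (G : Type*) [Group G] :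
    ((MulAut.conj : G →* MulAut G).range).Normal where
  conj_mem := by
    rintro _ ⟨g, rfl⟩ f
    refine ⟨f g, ?_⟩
    ext x
    simp [MulAut.conj_apply]

/-- The outer automorphism group `Out(G) = Aut(G) / Inn(G)`. -/
abbrev OutAut (G : Type*) [Group G] : Type _ :=
  MulAut G ⧸ (MulAut.conj : G →* MulAut G).range

/-- The permutation action of `Aut(G)` on conjugacy classes, `f [g] = [f g]`. -/
def autConjClasses (G : Type*) [Group G] : MulAut G →* Equiv.Perm (ConjClasses G) where
  toFun f :=
    { toFun := ConjClasses.map f.toMonoidHom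
      invFun := ConjClasses.map f.symm.toMonoidHom
      left_inv := by
        intro c
        obtain ⟨a, rfl⟩ := ConjClasses.exists_rep c
        exact congrArg ConjClasses.mk (f.symm_apply_apply a)
      right_inv := by
        intro c
        obtain ⟨a, rfl⟩ := ConjClasses.exists_rep c
        exact congrArg ConjClasses.mk (f.apply_symm_apply a) }
  map_one' := by
    ext c
    obtain ⟨a, rfl⟩ := ConjClasses.exists_rep c
    rfl
  map_mul' f f' := by
    ext c
    obtain ⟨a, rfl⟩ := ConjClasses.exists_rep c
    rfl

/-- The induced permutation action of `Out(G)` on conjugacy classes: inner automorphisms act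
trivially, so the action of `Aut(G)` descends. -/
def outConjClasses (G : Type*) [Group G] : OutAut G →* Equiv.Perm (ConjClasses G) :=
  QuotientGroup.lift _ (autConjClasses G) (by
    rintro _ ⟨g, rfl⟩
    ext c
    obtain ⟨a, rfl⟩ := ConjClasses.exists_rep c
    exact ConjClasses.mk_eq_mk_iff_isConj.mpr (isConj_iff.mpr ⟨g⁻¹, by
        simp [mul_assoc]⟩))

instance outAutMulAction (G : Type*) [Group G] : MulAction (OutAut G) (ConjClasses G) :=
  MulAction.compHom (ConjClasses G) (outConjClasses G)

theorem outAut_mk_smul_mk {G : Type*} [Group G] (f : MulAut G) (g : G) :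
    (QuotientGroup.mk f : OutAut G) • ConjClasses.mk g = ConjClasses.mk (f g) := rfl

/-- The cyclically reduced length `‖g‖_A` of an element `g` of the free group `F(A)`: the length of
the word obtained from the freely reduced form of `g` by cyclic reduction. -/
def cyclicLength {α : Type*} [DecidableEq α] (g : FreeGroup α) : ℕ :=
  (FreeGroup.reduceCyclically g.toWord).length

theorem norm_pow_eq_cyclicLength {α : Type*} [DecidableEq α] (g : FreeGroup α) (n : ℕ) :
    (g ^ (n + 1)).norm
      = 2 * (FreeGroup.reduceCyclically.conjugator g.toWord).length
        + (n + 1) * cyclicLength g := by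
  rw [FreeGroup.norm, FreeGroup.toWord_pow,
    FreeGroup.reduceCyclically.reduce_flatten_replicate_succ FreeGroup.isReduced_toWord]
  simp [cyclicLength]
  ring

theorem cyclicLength_le_of_isConj {α : Type*} [DecidableEq α] {g h : FreeGroup α}
    (hgh : IsConj g h) : cyclicLength h ≤ cyclicLength g := by
  obtain ⟨c, rfl⟩ := isConj_iff.mp hgh
  by_contra! hlt
  set k := (FreeGroup.reduceCyclically.conjugator g.toWord).length with hk
  have key : ∀ n : ℕ, (n + 1) * cyclicLength (c * g * c⁻¹)
      ≤ 2 * c.norm + 2 * k + (n + 1) * cyclicLength g := by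
    intro n
    have h1 := norm_pow_eq_cyclicLength (c * g * c⁻¹) n
    have h2 := norm_pow_eq_cyclicLength g n
    rw [conj_pow] at h1
    have h3 := FreeGroup.norm_mul_le (c * g ^ (n + 1)) c⁻¹
    have h4 := FreeGroup.norm_mul_le c (g ^ (n + 1))
    rw [FreeGroup.norm_inv_eq] at h3
    omega
  have h5 := key (2 * c.norm + 2 * k)
  nlinarith

theorem cyclicLength_eq_of_isConj {α : Type*} [DecidableEq α] {g h : FreeGroup α}
    (hgh : IsConj g h) : cyclicLength g = cyclicLength h :=
  le_antisymm (cyclicLength_le_of_isConj hgh.symm) (cyclicLength_le_of_isConj hgh)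

/-- The cyclically reduced length as a function of the conjugacy class. -/
def conjLength {α : Type*} [DecidableEq α] (c : ConjClasses (FreeGroup α)) : ℕ :=
  Quotient.lift cyclicLength (fun _ _ h => cyclicLength_eq_of_isConj h) c

/-- A finite set `S` of nontrivial conjugacy classes of `F_N` is `(M, lam, ε)`-minimizing. The
parameters are meant to satisfy `1 ≤ M`, `1 < lam` and `0 ≤ ε < lam - 1`. -/
structure IsMinimizingSet {N : ℕ} (M : ℕ) (lam ε : ℝ)
    (S : Finset (ConjClasses (FreeGroup (Fin N)))) : Prop where
  nontrivial : ∀ c ∈ S, c ≠ ConjClasses.mk 1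
  card_le : S.card ≤ M
  same_orbit : ∀ c ∈ S, ∀ c' ∈ S,
    MulAction.orbit (OutAut (FreeGroup (Fin N))) c
      = MulAction.orbit (OutAut (FreeGroup (Fin N))) c'
  ratio_mem : ∀ c ∈ S, ∀ c' ∈ S,
    1 - ε ≤ (conjLength c' : ℝ) / conjLength c ∧ (conjLength c' : ℝ) / conjLength c ≤ 1 + ε
  le_ratio : ∀ c ∈ S, ∀ φ : OutAut (FreeGroup (Fin N)), φ • c ∉ S →
    lam ≤ (conjLength (φ • c) : ℝ) / conjLength c

/-- A conjugacy class is `(M, lam, ε)`-minimal if it lies in some `(M, lam, ε)`-minimizing set. -/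
def IsMLEMinimal {N : ℕ} (M : ℕ) (lam ε : ℝ) (c : ConjClasses (FreeGroup (Fin N))) : Prop :=
  ∃ S : Finset (ConjClasses (FreeGroup (Fin N))), IsMinimizingSet M lam ε S ∧ c ∈ S

/-!
The conjugacy classes of least length in the orbit `Out(F)[u]` all lie in the minimizing set, so
there are at most `M` of them. The main point is that every outer automorphism taking one such class
to another is a product of outer automorphisms from a finite set `basicOuter`, depending only on the
rank, along which the class stays among those of least length (`reachable_of_minimal`). Then the
stabilizer of such a class is generated by loops, one for each class of least length and basic move
(`rank_stabilizer_le_of_reachable`), so by at most `M` times the number of basic moves.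

The chain of moves is found from one form of Whitehead's theorem: if no Whitehead automorphism
shortens a finite list `U` of elements (in total cyclic length), then no automorphism does
(`WhiteheadMinimal.totalLength_le`). To connect `u` to `φ u`, both of least length, it is applied to
a list formed by many copies of `ψ u` and of the images under `ψ * φ⁻¹` of the test words, which
are the generators and their pairwise products. As long as a Whitehead automorphism shortens this
list, it shortens the images of the test words and keeps the length of `ψ u`; when none does,
`ψ * φ⁻¹` does not lengthen the test words, and there are only finitely many such outer
automorphisms (`finite_shortOuter`), because an automorphism fixing the conjugacy classes of all test
words is inner.

The proof of Whitehead's theorem uses neither peak reduction nor generators of the automorphism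
group. For an almost invariant set `X ⊆ F`, let `cross g X` be the number of `h` such that `X` contains
exactly one of `h` and `h * g`. The word length of `g` is the sum of `cross g X` over the `X` formed by
the elements whose reduced word starts with a given generator (`norm_eq_sum_cross`), so the total
length of `U` in any basis is the growth rate in `k` of the crossings of the `u ^ k` with the walls of
that basis, and these walls are almost invariant sets. A Whitehead automorphism replaces one wall by
the wall of a cut of the alphabet. Hence, if none shortens `U`, a cut separating a letter from its
inverse is crossed at least as often as the wall of that letter. The same then holds for every almost
invariant set separating the two ends of the axis of a letter: such a set is reduced to a cut by
pruning the finite part of the Cayley tree where it is not constant, one extremal vertex at a time,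
and submodularity of `cross` shows that pruning does not increase crossings
(`WhiteheadMinimal.prune`). Finally, the walls of any other basis can be matched with the letters so
that each wall has nonzero exponent sum along its letter, the determinant of the abelianized
automorphism being nonzero; such a wall has a translate separating the ends of the axis of its
letter. Summation over the matching gives the theorem.
-/

/-! ### Letters and cylinders -/

namespace Whitehead

open FreeGroup hiding map_mul map_one map_inv

variable {α : Type*}

/-- The inverse of a letter. -/
def bar (x : α × Bool) : α × Bool := (x.1, !x.2)

@[simp] theorem bar_bar (x : α × Bool) : bar (bar x) = x := by simp [bar]

@[simp] theorem bar_fst (x : α × Bool) : (bar x).1 = x.1 := rfl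

theorem bar_ne (x : α × Bool) : bar x ≠ x := by
  intro h
  have := congrArg Prod.snd h
  simp [bar] at this

theorem fst_eq_iff {x y : α × Bool} : x.1 = y.1 ↔ x = y ∨ x = bar y := by
  obtain ⟨a, b⟩ := x
  obtain ⟨c, d⟩ := y
  cases b <;> cases d <;> simp [bar]

/-- The element of the free group given by a letter. -/
def letter (x : α × Bool) : FreeGroup α := FreeGroup.mk [x]

theorem letter_bar (x : α × Bool) : letter (bar x) = (letter x)⁻¹ := by
  simp [letter, bar, inv_mk, invRev]

@[simp] theorem letter_mul_letter_bar (x : α × Bool) : letter x * letter (bar x) = 1 := by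
  simp [letter_bar]

@[simp] theorem letter_bar_mul_letter (x : α × Bool) : letter (bar x) * letter x = 1 := by
  simp [letter_bar]

theorem letter_true (a : α) : letter (a, true) = FreeGroup.of a := rfl

theorem letter_false (a : α) : letter (a, false) = (FreeGroup.of a)⁻¹ := rfl

variable [DecidableEq α]

@[simp] theorem toWord_letter (x : α × Bool) : (letter x).toWord = [x] := by
  simp [letter, toWord_mk]

/-- The elements of the free group whose reduced word begins with the letter `x`: the vertices of
the Cayley tree on the far side of the edge from `1` to `x`. -/
def cyl (x : α × Bool) : Set (FreeGroup α) := {g | g.toWord.head? = some x}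

theorem mem_cyl {x : α × Bool} {g : FreeGroup α} : g ∈ cyl x ↔ g.toWord.head? = some x := Iff.rfl

@[simp] theorem one_notMem_cyl (x : α × Bool) : (1 : FreeGroup α) ∉ cyl x := by simp [mem_cyl]

@[simp] theorem letter_mem_cyl {x y : α × Bool} : letter x ∈ cyl y ↔ x = y := by
  simp [mem_cyl]

theorem cyl_unique {x y : α × Bool} {g : FreeGroup α} (hx : g ∈ cyl x) (hy : g ∈ cyl y) :
    x = y := by
  rw [mem_cyl] at hx hy
  simpa [hx] using hy

theorem eq_one_or_exists_mem_cyl (g : FreeGroup α) : g = 1 ∨ ∃ x, g ∈ cyl x := by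
  rcases h : g.toWord with _ | ⟨x, t⟩
  · left; exact toWord_eq_nil_iff.mp h
  · right; exact ⟨x, by simp [mem_cyl, h]⟩

theorem toWord_mul_eq_append {g h : FreeGroup α} (H : ∀ x, g⁻¹ ∈ cyl x → h ∉ cyl x) :
    (g * h).toWord = g.toWord ++ h.toWord := by
  rw [toWord_mul]
  apply IsReduced.reduce_eq
  refine List.isChain_append.mpr ⟨isReduced_toWord, isReduced_toWord, ?_⟩
  intro x hx y hy h1
  by_contra h2
  refine H y ?_ hy
  have : bar x = y := by
    obtain ⟨a, b⟩ := x; obtain ⟨c, d⟩ := y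
    simp only at h1 h2
    subst h1
    cases b <;> cases d <;> simp_all [bar]
  rw [mem_cyl, toWord_inv, invRev, List.head?_reverse, List.getLast?_map, hx, ← this]
  rfl

theorem toWord_letter_mul {x : α × Bool} {g : FreeGroup α} (hg : g ∉ cyl (bar x)) :
    (letter x * g).toWord = x :: g.toWord := by
  rw [toWord_mul_eq_append, toWord_letter, List.singleton_append]
  intro y hy
  rw [← letter_bar, letter_mem_cyl] at hy
  exact hy ▸ hg

theorem letter_mul_mem_cyl {x : α × Bool} {g : FreeGroup α} (hg : g ∉ cyl (bar x)) :
    letter x * g ∈ cyl x := by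
  simp [mem_cyl, toWord_letter_mul hg]

theorem exists_eq_letter_mul {x : α × Bool} {g : FreeGroup α} (hg : g ∈ cyl x) :
    ∃ h, h ∉ cyl (bar x) ∧ g = letter x * h := by
  refine ⟨letter (bar x) * g, fun hh => ?_, by simp [letter_bar]⟩
  rcases hw : g.toWord with _ | ⟨y, t⟩
  · simp [mem_cyl, hw] at hg
  obtain rfl : y = x := by simpa [mem_cyl, hw] using hg
  have hr : IsReduced (y :: t) := hw ▸ isReduced_toWord
  have ht : IsReduced t := hr.infix (List.suffix_cons y t).isInfix
  have e : letter (bar y) * g = FreeGroup.mk t := by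
    have hg' : g = letter y * FreeGroup.mk t := by
      rw [letter, mul_mk, List.singleton_append, ← hw, mk_toWord]
    rw [hg', letter_bar, inv_mul_cancel_left]
  rw [e, mem_cyl, toWord_mk, ht.reduce_eq] at hh
  rcases t with _ | ⟨z, s⟩
  · simp at hh
  · have := (isReduced_cons_cons.mp hr).1
    obtain rfl : z = bar y := by simpa using hh
    simp [bar] at this

/-- Induction along reduced words, adding letters on the left. -/
theorem reduced_induction {P : FreeGroup α → Prop} (one : P 1)
    (cons : ∀ x g, g ∉ cyl (bar x) → P g → P (letter x * g)) (g : FreeGroup α) : P g := by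
  induction hn : g.norm generalizing g with
  | zero => rw [FreeGroup.norm_eq_zero] at hn; exact hn ▸ one
  | succ n ih =>
    rcases eq_one_or_exists_mem_cyl g with rfl | ⟨x, hx⟩
    · exact one
    obtain ⟨h, hh, rfl⟩ := exists_eq_letter_mul hx
    refine cons x h hh (ih h ?_)
    simpa [FreeGroup.norm, toWord_letter_mul hh] using hn

/-- Induction along reduced words, adding letters on the right. -/
theorem reduced_induction_right {P : FreeGroup α → Prop} (one : P 1)
    (snoc : ∀ g x, g⁻¹ ∉ cyl x → P g → P (g * letter x)) (g : FreeGroup α) : P g := by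
  have := reduced_induction (P := fun g => P g⁻¹) (by simpa using one) (fun x g hg h => by
    rw [mul_inv_rev, ← letter_bar]
    exact snoc _ _ (by simpa using hg) h) g⁻¹
  simpa using this

theorem norm_mul_letter {g : FreeGroup α} {x : α × Bool} (h : g⁻¹ ∉ cyl x) :
    (g * letter x).norm = g.norm + 1 := by
  rw [FreeGroup.norm, toWord_mul_eq_append, toWord_letter, List.length_append]; · rfl
  rintro y hy hxy
  rw [letter_mem_cyl] at hxy
  exact h (hxy ▸ hy)

/-- Right multiplication by a letter changes membership in a cylinder only across the edge
from `1` to `x`. -/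
theorem mul_letter_mem_cyl_iff {g : FreeGroup α} {x z : α × Bool}
    (h1 : ¬(g = 1 ∧ z = x)) (h2 : ¬(g = letter x ∧ z = bar x)) :
    g * letter z ∈ cyl x ↔ g ∈ cyl x := by
  induction g using reduced_induction generalizing x with
  | one =>
    simp only [true_and, one_mul, letter_mem_cyl, one_notMem_cyl, iff_false] at h1 ⊢
    exact h1
  | cons y g hg ih =>
    by_cases hc : g = 1 ∧ z = bar y
    · obtain ⟨rfl, rfl⟩ := hc
      rw [mul_one] at h2 ⊢
      simp only [letter_mul_letter_bar, one_notMem_cyl, letter_mem_cyl, false_iff]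
      rintro rfl
      simp at h2
    · have hg' : g * letter z ∉ cyl (bar y) := by
        rwa [ih hc]
        rintro ⟨rfl, -⟩
        simp at hg
      have a := letter_mul_mem_cyl hg
      have b := letter_mul_mem_cyl hg'
      rw [← mul_assoc] at b
      constructor
      · intro h; rw [← cyl_unique b h]; exact a
      · intro h; rw [← cyl_unique a h]; exact b

/-! ### Boundary counts -/

/-- The left endpoints `h` of the pairs `(h, h * g)` separated by `X`. -/
def bd {G : Type*} [Group G] (g : G) (X : Set G) : Set G := {h | ¬(h ∈ X ↔ h * g ∈ X)}

/-- The number of pairs `(h, h * g)` separated by `X`. -/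
noncomputable def cross {G : Type*} [Group G] (g : G) (X : Set G) : ℕ := (bd g X).ncard

/-- A set is almost invariant if each right translation changes it by a finite set only. -/
def AlmostInvariant {G : Type*} [Group G] (X : Set G) : Prop := ∀ g, (bd g X).Finite

section Group

variable {G : Type*} [Group G] {X Y : Set G}

theorem mem_bd {g h : G} : h ∈ bd g X ↔ ¬(h ∈ X ↔ h * g ∈ X) := Iff.rfl

theorem bd_compl (g : G) (X : Set G) : bd g Xᶜ = bd g X := by
  ext h; simp only [mem_bd, Set.mem_compl_iff]; tauto

theorem cross_compl (g : G) (X : Set G) : cross g Xᶜ = cross g X := by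
  rw [cross, bd_compl, cross]

theorem AlmostInvariant.compl (hX : AlmostInvariant X) : AlmostInvariant Xᶜ :=
  fun g => by rw [bd_compl]; exact hX g

theorem bd_inter_subset (g : G) (X Y : Set G) : bd g (X ∩ Y) ⊆ bd g X ∪ bd g Y := by
  intro h; simp only [mem_bd, Set.mem_inter_iff, Set.mem_union]; tauto

theorem bd_union_subset (g : G) (X Y : Set G) : bd g (X ∪ Y) ⊆ bd g X ∪ bd g Y := by
  intro h; simp only [mem_bd, Set.mem_union]; tauto

theorem AlmostInvariant.inter (hX : AlmostInvariant X) (hY : AlmostInvariant Y) :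
    AlmostInvariant (X ∩ Y) :=
  fun g => ((hX g).union (hY g)).subset (bd_inter_subset g X Y)

theorem AlmostInvariant.union (hX : AlmostInvariant X) (hY : AlmostInvariant Y) :
    AlmostInvariant (X ∪ Y) :=
  fun g => ((hX g).union (hY g)).subset (bd_union_subset g X Y)

/-- Boundary counts are submodular. -/
theorem cross_inter_add_cross_union_le (hX : AlmostInvariant X) (hY : AlmostInvariant Y) (g : G) :
    cross g (X ∩ Y) + cross g (X ∪ Y) ≤ cross g X + cross g Y := by
  have f1 := (hX.inter hY) g
  have f2 := (hX.union hY) g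
  rw [cross, cross, ← Set.ncard_union_add_ncard_inter _ _ f1 f2, cross, cross,
    ← Set.ncard_union_add_ncard_inter _ _ (hX g) (hY g)]
  refine add_le_add (Set.ncard_le_ncard ?_ ((hX g).union (hY g)))
    (Set.ncard_le_ncard ?_ ((hX g).inter_of_left _))
  · exact Set.union_subset (bd_inter_subset g X Y) (bd_union_subset g X Y)
  · intro h; simp only [mem_bd, Set.mem_inter_iff, Set.mem_union]; tauto

/-- Left translates are written as preimages. -/
theorem bd_translate (g v : G) (X : Set G) :
    bd g ((v * ·) ⁻¹' X) = (v * ·) ⁻¹' bd g X := by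
  ext h; simp [mem_bd, mul_assoc]

theorem AlmostInvariant.translate (hX : AlmostInvariant X) (v : G) :
    AlmostInvariant ((v * ·) ⁻¹' X) := fun g => by
  rw [bd_translate]; exact (hX g).preimage (mul_right_injective v).injOn

theorem cross_translate (g v : G) (X : Set G) : cross g ((v * ·) ⁻¹' X) = cross g X := by
  rw [cross, bd_translate, cross]
  exact Set.ncard_preimage_of_injective_subset_range (mul_right_injective v)
    (by rw [(Group.mulLeft_bijective v).surjective.range_eq]; exact Set.subset_univ _)

/-- Boundary counts are transported by automorphisms. -/
theorem bd_comap (f : MulAut G) (g : G) (X : Set G) : bd g (f ⁻¹' X) = f ⁻¹' bd (f g) X := by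
  ext h; simp [mem_bd]

theorem cross_comap (f : MulAut G) (g : G) (X : Set G) :
    cross g (f ⁻¹' X) = cross (f g) X := by
  rw [cross, bd_comap, cross]
  exact Set.ncard_preimage_of_injective_subset_range f.injective
    (by rw [f.surjective.range_eq]; exact Set.subset_univ _)

theorem AlmostInvariant.comap (hX : AlmostInvariant X) (f : MulAut G) :
    AlmostInvariant (f ⁻¹' X) := fun g => by
  rw [bd_comap]; exact (hX _).preimage f.injective.injOn

/-- Changing a set at finitely many elements changes boundary counts by a bounded amount. -/
theorem cross_le_add_of_agree_off (hY : AlmostInvariant Y) {E : Set G} (hE : E.Finite)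
    (h : ∀ x ∉ E, (x ∈ X ↔ x ∈ Y)) (g : G) : cross g X ≤ cross g Y + 2 * E.ncard := by
  have hsub : bd g X ⊆ bd g Y ∪ (E ∪ (· * g) ⁻¹' E) := by
    intro x hx
    by_contra hc
    simp only [Set.mem_union, Set.mem_preimage, not_or] at hc
    apply hc.1
    rw [mem_bd, ← h _ hc.2.1, ← h _ hc.2.2]
    exact hx
  have e : ((· * g) ⁻¹' E).ncard = E.ncard :=
    Set.ncard_preimage_of_injective_subset_range (mul_left_injective g)
      (by rw [(Group.mulRight_bijective g).surjective.range_eq]; exact Set.subset_univ _)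
  have f : ((· * g) ⁻¹' E).Finite := hE.preimage (mul_left_injective g).injOn
  calc cross g X ≤ (bd g Y ∪ (E ∪ (· * g) ⁻¹' E)).ncard :=
        Set.ncard_le_ncard hsub ((hY g).union (hE.union f))
    _ ≤ (bd g Y).ncard + (E.ncard + ((· * g) ⁻¹' E).ncard) :=
        (Set.ncard_union_le _ _).trans (Nat.add_le_add_left (Set.ncard_union_le _ _) _)
    _ = cross g Y + 2 * E.ncard := by rw [e, cross]; ring

theorem bd_mul (g h : G) (X : Set G) :
    bd (g * h) X = symmDiff (bd g X) ((· * g) ⁻¹' bd h X) := by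
  ext k; simp only [mem_bd, Set.mem_symmDiff, Set.mem_preimage, mul_assoc]; tauto

end Group

theorem bd_letter_cyl (x z : α × Bool) : bd (letter z) (cyl x) =
    {h | (h = 1 ∧ z = x) ∨ (h = letter x ∧ z = bar x)} := by
  ext h
  rw [mem_bd, Set.mem_ofPred_eq]
  constructor
  · intro hh
    by_contra hc
    rw [not_or] at hc
    exact hh (mul_letter_mem_cyl_iff hc.1 hc.2).symm
  · rintro (⟨rfl, rfl⟩ | ⟨rfl, rfl⟩) <;> simp

theorem almostInvariant_of_letter {X : Set (FreeGroup α)}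
    (h : ∀ z, (bd (letter z) X).Finite) : AlmostInvariant X := by
  intro g
  induction g using reduced_induction with
  | one => simp [bd]
  | cons x g _ ih =>
    rw [bd_mul]
    exact ((h x).union (ih.preimage (mul_left_injective _).injOn)).subset
      Set.symmDiff_subset_union

theorem almostInvariant_cyl (x : α × Bool) : AlmostInvariant (cyl x) := by
  refine almostInvariant_of_letter fun z => ?_
  rw [bd_letter_cyl]
  refine (Set.toFinite {1, letter x}).subset ?_
  rintro h (h | h) <;> simp [h.1]

/-- A letter appended without cancellation contributes one crossing to its own cylinder. -/
theorem cross_mul_letter {g : FreeGroup α} {z : α × Bool} (hg : g⁻¹ ∉ cyl z) (x : α × Bool) :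
    cross (g * letter z) (cyl x) = cross g (cyl x) + if z.1 = x.1 then 1 else 0 := by
  rw [cross, bd_mul, bd_letter_cyl, cross]
  by_cases h : z.1 = x.1
  · rw [if_pos h]
    rcases fst_eq_iff.mp h with rfl | rfl
    · have e : (· * g) ⁻¹' {h | (h = 1 ∧ z = z) ∨ (h = letter z ∧ z = bar z)} = {g⁻¹} := by
        ext h; simp [(bar_ne z).symm]
      have hn : g⁻¹ ∉ bd g (cyl z) := by simp [mem_bd, hg]
      rw [e, (Set.disjoint_singleton_right.mpr hn).symmDiff_eq_sup]
      change (_ ∪ _ : Set _).ncard = _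
      rw [Set.union_singleton, Set.ncard_insert_of_notMem hn (almostInvariant_cyl z g)]
    · have e : (· * g) ⁻¹' {h | (h = 1 ∧ bar x = x) ∨ (h = letter x ∧ bar x = bar x)}
          = {letter x * g⁻¹} := by
        ext h; simp [bar_ne x, eq_mul_inv_iff_mul_eq]
      have hn : letter x * g⁻¹ ∉ bd g (cyl x) := by
        simp [mem_bd, letter_mul_mem_cyl hg]
      rw [e, (Set.disjoint_singleton_right.mpr hn).symmDiff_eq_sup]
      change (_ ∪ _ : Set _).ncard = _
      rw [Set.union_singleton, Set.ncard_insert_of_notMem hn (almostInvariant_cyl x g)]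
  · rw [if_neg h, add_zero]
    have h1 : z ≠ x := fun e => h (e ▸ rfl)
    have h2 : z ≠ bar x := fun e => h (e ▸ rfl)
    simp only [h1, h2, and_false, or_false, Set.ofPred_false, Set.preimage_empty]
    rw [← Set.bot_eq_empty, symmDiff_bot]

@[simp] theorem cross_one {G : Type*} [Group G] (X : Set G) : cross 1 X = 0 := by
  simp [cross, bd]

/-- The length of a reduced word is the number of walls it crosses. -/
theorem norm_eq_sum_cross [Fintype α] (g : FreeGroup α) :
    g.norm = ∑ a, cross g (cyl (a, true)) := by
  induction g using reduced_induction_right with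
  | one => simp
  | snoc g z hg ih =>
    simp only [norm_mul_letter hg, cross_mul_letter hg, Finset.sum_add_distrib, ih]
    simp

/-- The two letters of a generator define the same wall. -/
theorem cross_cyl_bar (g : FreeGroup α) (x : α × Bool) :
    cross g (cyl (bar x)) = cross g (cyl x) := by
  induction g using reduced_induction_right with
  | one => simp
  | snoc g z hg ih => rw [cross_mul_letter hg, cross_mul_letter hg, ih]; rfl

end Whitehead

/-! ### Whitehead automorphisms -/

namespace Whitehead

open FreeGroup hiding map_mul map_one map_inv

variable {α : Type*} [DecidableEq α]

/-- The endomorphism `z ↦ d ^ [z ∈ A] * z * d ^ (-[bar z ∈ A])` that fixes the generator `a`. -/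
def twistHom (A : Finset (α × Bool)) (a : α) (d : FreeGroup α) : FreeGroup α →* FreeGroup α :=
  FreeGroup.lift fun i => if i = a then of i else
    (if (i, true) ∈ A then d else 1) * of i * (if (i, false) ∈ A then d else 1)⁻¹

theorem twistHom_letter_same (A : Finset (α × Bool)) (d : FreeGroup α) (z : α × Bool) :
    twistHom A z.1 d (letter z) = letter z := by
  obtain ⟨i, _ | _⟩ := z <;> simp [letter_true, letter_false, twistHom]

theorem twistHom_letter (A : Finset (α × Bool)) {a : α} (d : FreeGroup α) {z : α × Bool}
    (h : z.1 ≠ a) : twistHom A a d (letter z) =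
      (if z ∈ A then d else 1) * letter z * (if bar z ∈ A then d else 1)⁻¹ := by
  obtain ⟨i, _ | _⟩ := z <;> simp only at h <;>
    simp only [letter_true, letter_false, twistHom, bar, h, map_inv, FreeGroup.lift_apply_of,
      if_false, Bool.not_true, Bool.not_false, mul_inv_rev, inv_inv, mul_assoc]

theorem twistHom_comp (A : Finset (α × Bool)) {a : α} {d : FreeGroup α}
    (hd : twistHom A a d⁻¹ d = d) :
    (twistHom A a d⁻¹).comp (twistHom A a d) = MonoidHom.id _ := by
  ext i
  rw [MonoidHom.comp_apply, MonoidHom.id_apply, ← letter_true]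
  by_cases h : i = a
  · subst h
    have := twistHom_letter_same A
    rw [this d (i, true), this d⁻¹ (i, true)]
  · rw [twistHom_letter A (z := (i, true)) d h]
    simp only [map_mul, map_inv]
    rw [twistHom_letter A (z := (i, true)) d⁻¹ h]
    split_ifs <;> simp [hd, mul_assoc]

/-- The Whitehead automorphism with cut `A` and multiplier `c`. It is of interest when `c ∈ A` and
`bar c ∉ A`. -/
def whitehead (A : Finset (α × Bool)) (c : α × Bool) : MulAut (FreeGroup α) :=
  MonoidHom.toMulEquiv (twistHom A c.1 (letter c)) (twistHom A c.1 (letter c)⁻¹)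
    (twistHom_comp A (twistHom_letter_same A _ c))
    (by
      have := twistHom_comp A (a := c.1) (d := (letter c)⁻¹)
        (by rw [inv_inv, map_inv, twistHom_letter_same])
      rwa [inv_inv] at this)

theorem whitehead_apply (A : Finset (α × Bool)) (c : α × Bool) (g : FreeGroup α) :
    whitehead A c g = twistHom A c.1 (letter c) g := rfl

theorem whitehead_letter_self (A : Finset (α × Bool)) (c : α × Bool) :
    whitehead A c (letter c) = letter c := twistHom_letter_same A _ c

/-- The elements whose first letter lies in `A`. -/
def cylSet (A : Finset (α × Bool)) : Set (FreeGroup α) := {g | ∃ z ∈ A, g ∈ cyl z}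

/-- How a Whitehead automorphism changes first letters. The last two clauses are only needed to
carry the induction. -/
theorem whitehead_firstLetter {A : Finset (α × Bool)} {c : α × Bool} (hc : c ∈ A)
    (hc' : bar c ∉ A) (g : FreeGroup α) :
    (whitehead A c g ∈ cyl c ↔ g ∈ cylSet A) ∧
    (∀ b ∉ A, b.1 ≠ c.1 → (whitehead A c g ∈ cyl b ↔ g ∈ cyl b)) ∧
    (∀ b ∈ A, b.1 ≠ c.1 → (letter (bar c) * whitehead A c g ∈ cyl b ↔ g ∈ cyl b)) ∧
    (whitehead A c g ∈ cyl (bar c) → g ∈ cyl (bar c)) ∧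
    (∀ b ∈ A, b.1 ≠ c.1 → whitehead A c g ∈ cyl b → g ∈ cyl (bar c)) := by
  have hset : ∀ {z : α × Bool} {g : FreeGroup α}, g ∈ cyl z → (g ∈ cylSet A ↔ z ∈ A) :=
    fun {z g} hz => ⟨fun ⟨y, hy, hy'⟩ => cyl_unique hz hy' ▸ hy, fun h => ⟨z, h, hz⟩⟩
  have hmem : ∀ {y z : α × Bool} {g : FreeGroup α}, g ∈ cyl z → (g ∈ cyl y ↔ z = y) :=
    fun {y z g} hz => ⟨fun h => cyl_unique hz h, fun h => h ▸ hz⟩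
  have hbar : bar c ≠ c := bar_ne c
  induction g using reduced_induction with
  | one =>
    refine ⟨by simp [cylSet], by simp, ?_, by simp, by simp⟩
    intro b _ hb
    simp only [map_one, mul_one, letter_mem_cyl, one_notMem_cyl, iff_false]
    rintro rfl
    simp at hb
  | cons z h hh ih =>
    obtain ⟨ihA, ihB, ihC, ihD, ihE⟩ := ih
    have hz := letter_mul_mem_cyl hh
    generalize hg : letter z * h = g at hz
    by_cases hzc : z.1 = c.1
    · rcases fst_eq_iff.mp hzc with rfl | rfl
      · have e : whitehead A z g = letter z * whitehead A z h := by
          rw [← hg, map_mul, whitehead_letter_self]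
        have h1 : whitehead A z g ∈ cyl z := e ▸ letter_mul_mem_cyl fun hf => hh (ihD hf)
        refine ⟨?_, ?_, ?_, ?_, ?_⟩
        · simp [hset hz, h1, hc]
        · intro b hb _; simp [hmem hz, hmem h1]
        · intro b hb hbz
          have : z ≠ b := fun hf => hbz (hf ▸ rfl)
          rw [hmem hz, e, ← mul_assoc, letter_bar_mul_letter, one_mul]
          simp only [this, iff_false]
          exact fun hf => hh (ihE b hb hbz hf)
        · intro hf; exact absurd (cyl_unique h1 hf).symm hbar
        · intro b _ hbz hf; exact absurd (cyl_unique h1 hf) fun hf => hbz (hf ▸ rfl)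
      · rw [bar_bar] at hh
        have e : whitehead A c g = letter (bar c) * whitehead A c h := by
          rw [← hg, map_mul, letter_bar, map_inv, whitehead_letter_self]
        have h1 : whitehead A c g ∈ cyl (bar c) ∨ ∃ y ∈ A, y ≠ c ∧ whitehead A c g ∈ cyl y := by
          by_cases hf : whitehead A c h ∈ cyl c
          · obtain ⟨y, hy, hhy⟩ := ihA.mp hf
            have hyc : y ≠ c := by rintro rfl; exact hh hhy
            refine Or.inr ⟨y, hy, hyc, ?_⟩
            rw [e, ihC y hy]
            · exact hhy
            · intro h0
              rcases fst_eq_iff.mp h0 with rfl | rfl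
              · exact hyc rfl
              · exact hc' hy
          · left; rw [e]; exact letter_mul_mem_cyl (by simpa using hf)
        have h2 : whitehead A c g ∉ cyl c := by
          rcases h1 with h1 | ⟨y, _, hy', h1⟩
          · rw [hmem h1]; exact hbar
          · rw [hmem h1]; exact hy'
        have h3 : letter (bar c) * whitehead A c g ∈ cyl (bar c) :=
          letter_mul_mem_cyl (by simpa using h2)
        refine ⟨?_, ?_, ?_, fun _ => hz, fun _ _ _ _ => hz⟩
        · simp [h2, hset hz, hc']
        · intro b hb hbc
          have : bar c ≠ b := fun hf => hbc (hf ▸ rfl)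
          simp only [hmem hz, this, iff_false]
          rcases h1 with h1 | ⟨y, hy, hy', h1⟩
          · rw [hmem h1]; exact this
          · rw [hmem h1]; rintro rfl; exact hb hy
        · intro b hb hbc
          rw [hmem h3, hmem hz]
    · set k := (if bar z ∈ A then letter c else 1)⁻¹ * whitehead A c h with hk
      have e : whitehead A c g = (if z ∈ A then letter c else 1) * (letter z * k) := by
        rw [← hg, map_mul, whitehead_apply, twistHom_letter A _ hzc, hk]
        simp only [mul_assoc]
      have hkz : k ∉ cyl (bar z) := by
        rw [hk]
        split_ifs with hz'
        · rw [← letter_bar, ihC _ hz' hzc]; exact hh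
        · rw [inv_one, one_mul, ihB _ hz' hzc]; exact hh
      have hzk := letter_mul_mem_cyl hkz
      have hzc1 : z ≠ c := fun h => hzc (h ▸ rfl)
      have hzc2 : z ≠ bar c := fun h => hzc (h ▸ rfl)
      by_cases hzA : z ∈ A
      · rw [if_pos hzA] at e
        have h1 : whitehead A c g ∈ cyl c := by
          rw [e]; refine letter_mul_mem_cyl ?_; rwa [hmem hzk]
        refine ⟨?_, ?_, ?_, ?_, ?_⟩
        · simp [h1, hset hz, hzA]
        · intro b hb hbc
          rw [hmem h1, hmem hz]
          exact iff_of_false (fun hf => hbc (hf ▸ rfl)) (fun hf => hb (hf ▸ hzA))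
        · intro b hb hbc
          rw [e, ← mul_assoc, letter_bar_mul_letter, one_mul, hmem hzk, hmem hz]
        · intro hf; exact absurd (cyl_unique h1 hf).symm hbar
        · intro b _ hbz hf; exact absurd (cyl_unique h1 hf) fun hf => hbz (hf ▸ rfl)
      · rw [if_neg hzA, one_mul] at e
        have h1 : whitehead A c g ∈ cyl z := e ▸ hzk
        have h3 : letter (bar c) * whitehead A c g ∈ cyl (bar c) :=
          letter_mul_mem_cyl (by rw [hmem h1, bar_bar]; exact hzc1)
        refine ⟨?_, ?_, ?_, ?_, ?_⟩
        · rw [hmem h1, hset hz]; exact iff_of_false hzc1 hzA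
        · intro b _ _; rw [hmem h1, hmem hz]
        · intro b hb hbc
          rw [hmem h3, hmem hz]
          exact iff_of_false (fun hf => hbc (hf ▸ rfl)) (fun hf => hzA (hf ▸ hb))
        · intro hf; exact absurd (cyl_unique h1 hf) hzc2
        · intro b hb _ hf; exact absurd (cyl_unique h1 hf ▸ hb) hzA

/-- The wall of the multiplier `c` is replaced by the wall of the cut `A`. -/
theorem cross_whitehead_cyl_self {A : Finset (α × Bool)} {c : α × Bool} (hc : c ∈ A)
    (hc' : bar c ∉ A) (g : FreeGroup α) :
    cross (whitehead A c g) (cyl c) = cross g (cylSet A) := by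
  rw [← cross_comap]
  congr 1
  ext h
  exact (whitehead_firstLetter hc hc' h).1

/-- The walls of the other letters are only translated. -/
theorem cross_whitehead_cyl_of_ne {A : Finset (α × Bool)} {c : α × Bool} (hc : c ∈ A)
    (hc' : bar c ∉ A) {b : α × Bool} (hb : b.1 ≠ c.1) (g : FreeGroup α) :
    cross (whitehead A c g) (cyl b) = cross g (cyl b) := by
  rw [← cross_comap]
  by_cases hbA : b ∈ A
  · rw [← cross_translate g (letter c) (cyl b)]
    congr 1
    ext h
    have := (whitehead_firstLetter hc hc' (letter c * h)).2.2.1 b hbA hb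
    rw [map_mul, whitehead_letter_self, ← mul_assoc, letter_bar_mul_letter, one_mul] at this
    exact this
  · congr 1
    ext h
    exact (whitehead_firstLetter hc hc' h).2.1 b hbA hb

end Whitehead

/-! ### Lengths and crossings of powers, up to bounded error -/

namespace Whitehead

open FreeGroup hiding map_mul map_one map_inv
open Filter

/-- Domination of integer sequences up to a bounded error. -/
def CoarseLE (f g : ℕ → ℕ) : Prop := ∃ E, ∀ k, f k ≤ g k + E

theorem CoarseLE.of_le {f g : ℕ → ℕ} (h : ∀ k, f k ≤ g k) : CoarseLE f g := ⟨0, h⟩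

theorem CoarseLE.trans {f g h : ℕ → ℕ} (h1 : CoarseLE f g) (h2 : CoarseLE g h) : CoarseLE f h := by
  obtain ⟨E, hE⟩ := h1
  obtain ⟨E', hE'⟩ := h2
  exact ⟨E' + E, fun k => by have := hE k; have := hE' k; omega⟩

theorem CoarseLE.add {f g f' g' : ℕ → ℕ} (h1 : CoarseLE f g) (h2 : CoarseLE f' g') :
    CoarseLE (fun k => f k + f' k) (fun k => g k + g' k) := by
  obtain ⟨E, hE⟩ := h1
  obtain ⟨E', hE'⟩ := h2
  exact ⟨E + E', fun k => by have := hE k; have := hE' k; dsimp only; omega⟩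

theorem CoarseLE.sum {ι : Type*} (s : Finset ι) {f g : ι → ℕ → ℕ}
    (h : ∀ i ∈ s, CoarseLE (f i) (g i)) :
    CoarseLE (fun k => ∑ i ∈ s, f i k) (fun k => ∑ i ∈ s, g i k) := by
  classical
  induction s using Finset.induction_on with
  | empty => exact .of_le fun k => by simp
  | insert i s hi ih =>
    simp only [Finset.sum_insert hi]
    exact (h i (by simp)).add (ih fun j hj => h j (by simp [hj]))

theorem CoarseLE.le_of_mul {m n : ℕ} (h : CoarseLE (fun k => k * m) (fun k => k * n)) :
    m ≤ n := by
  obtain ⟨E, hE⟩ := h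
  by_contra! hlt
  have := hE (E + 1)
  nlinarith

variable {α : Type*}

/-- The total number of pairs `(h, h * u ^ k)`, `u ∈ U`, separated by `X`. -/
noncomputable def crossPow {G : Type*} [Group G] (U : List G) (X : Set G) (k : ℕ) : ℕ :=
  (U.map fun u => cross (u ^ k) X).sum

section Group

variable {G : Type*} [Group G] {X Y : Set G}

theorem crossPow_compl (U : List G) (X : Set G) : crossPow U Xᶜ = crossPow U X := by
  ext k; simp only [crossPow, cross_compl]

theorem crossPow_translate (U : List G) (v : G) (X : Set G) :
    crossPow U ((v * ·) ⁻¹' X) = crossPow U X := by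
  ext k; simp only [crossPow, cross_translate]

theorem crossPow_comap (f : MulAut G) (U : List G) (X : Set G) :
    crossPow U (f ⁻¹' X) = crossPow (U.map f) X := by
  ext k
  simp only [crossPow, cross_comap, List.map_map, map_pow]
  rfl

theorem crossPow_inter_add_union_le (hX : AlmostInvariant X) (hY : AlmostInvariant Y)
    (U : List G) (k : ℕ) :
    crossPow U (X ∩ Y) k + crossPow U (X ∪ Y) k ≤ crossPow U X k + crossPow U Y k := by
  induction U with
  | nil => simp [crossPow]
  | cons u U ih =>
    have := cross_inter_add_cross_union_le hX hY (u ^ k)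
    simp only [crossPow, List.map_cons, List.sum_cons] at ih ⊢
    omega

theorem crossPow_coarseLE_of_agree_off (hY : AlmostInvariant Y) {E : Set G} (hE : E.Finite)
    (h : ∀ x ∉ E, (x ∈ X ↔ x ∈ Y)) (U : List G) : CoarseLE (crossPow U X) (crossPow U Y) := by
  induction U with
  | nil => exact .of_le fun k => by simp [crossPow]
  | cons u U ih =>
    have h1 : CoarseLE (fun k => cross (u ^ k) X) (fun k => cross (u ^ k) Y) :=
      ⟨_, fun k => cross_le_add_of_agree_off hY hE h (u ^ k)⟩
    exact h1.add ih

end Group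

variable [DecidableEq α]

/-- The total cyclically reduced length of a list of elements. -/
def totalLength (U : List (FreeGroup α)) : ℕ := (U.map cyclicLength).sum

theorem mul_cyclicLength_le (u : FreeGroup α) (k : ℕ) : k * cyclicLength u ≤ (u ^ k).norm := by
  cases k with
  | zero => simp
  | succ k => rw [norm_pow_eq_cyclicLength]; omega

theorem norm_pow_le (u : FreeGroup α) (k : ℕ) : (u ^ k).norm ≤ k * cyclicLength u +
    2 * (FreeGroup.reduceCyclically.conjugator u.toWord).length := by
  cases k with
  | zero => simp
  | succ k => rw [norm_pow_eq_cyclicLength]; omega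

theorem crossPow_cyl_bar (U : List (FreeGroup α)) (x : α × Bool) :
    crossPow U (cyl (bar x)) = crossPow U (cyl x) := by
  ext k; simp only [crossPow, cross_cyl_bar]

variable [Fintype α]

theorem sum_norm_pow_eq (U : List (FreeGroup α)) (k : ℕ) :
    (U.map fun u => (u ^ k).norm).sum = ∑ a, crossPow U (cyl (a, true)) k := by
  induction U with
  | nil => simp [crossPow]
  | cons u U ih =>
    simp only [crossPow, List.map_cons, List.sum_cons, Finset.sum_add_distrib] at ih ⊢
    rw [ih, norm_eq_sum_cross]

/-- The total length of `U` is the asymptotic rate at which powers of its elements cross the walls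
of the basis. -/
theorem totalLength_coarseLE (U : List (FreeGroup α)) :
    CoarseLE (fun k => k * totalLength U) (fun k => ∑ a, crossPow U (cyl (a, true)) k) := by
  refine .of_le fun k => ?_
  rw [← sum_norm_pow_eq]
  induction U with
  | nil => simp [totalLength]
  | cons u U ih =>
    have := mul_cyclicLength_le u k
    simp only [totalLength, List.map_cons, List.sum_cons, mul_add] at ih ⊢
    omega

theorem coarseLE_totalLength (U : List (FreeGroup α)) :
    CoarseLE (fun k => ∑ a, crossPow U (cyl (a, true)) k) (fun k => k * totalLength U) := by
  simp only [← sum_norm_pow_eq]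
  induction U with
  | nil => exact .of_le fun k => by simp
  | cons u U ih =>
    have h1 : CoarseLE (fun k => (u ^ k).norm) (fun k => k * cyclicLength u) := ⟨_, norm_pow_le u⟩
    simpa only [totalLength, List.map_cons, List.sum_cons, mul_add] using h1.add ih

/-- No Whitehead automorphism shortens `U`. -/
def WhiteheadMinimal (U : List (FreeGroup α)) : Prop :=
  ∀ A c, c ∈ A → bar c ∉ A → totalLength U ≤ totalLength (U.map (whitehead A c))

/-- The cut inequalities: in a Whitehead minimal position, a cut separating `c` from its inverse
is crossed at least as often as the wall of `c`. -/
theorem WhiteheadMinimal.crossPow_cyl_le {U : List (FreeGroup α)} (hU : WhiteheadMinimal U)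
    {A : Finset (α × Bool)} {c : α × Bool} (hc : c ∈ A) (hc' : bar c ∉ A) :
    CoarseLE (crossPow U (cyl c)) (crossPow U (cylSet A)) := by
  have hwall : ∀ (V : List (FreeGroup α)), crossPow V (cyl (c.1, true)) = crossPow V (cyl c) := by
    intro V
    obtain ⟨i, _ | _⟩ := c
    · exact crossPow_cyl_bar V (i, false)
    · rfl
  have hself : crossPow (U.map (whitehead A c)) (cyl c) = crossPow U (cylSet A) := by
    ext k
    simp only [crossPow, List.map_map, Function.comp_def, ← map_pow, cross_whitehead_cyl_self hc hc']
  have hne : ∀ b ∈ Finset.univ.erase c.1,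
      crossPow (U.map (whitehead A c)) (cyl (b, true)) = crossPow U (cyl (b, true)) := by
    intro b hb
    ext k
    have hb' : (b, true).1 ≠ c.1 := Finset.ne_of_mem_erase hb
    simp only [crossPow, List.map_map, Function.comp_def, ← map_pow,
      cross_whitehead_cyl_of_ne hc hc' hb']
  have h := (coarseLE_totalLength U).trans ((CoarseLE.of_le fun k =>
    Nat.mul_le_mul_left k (hU A c hc hc')).trans (totalLength_coarseLE (U.map (whitehead A c))))
  obtain ⟨E, hE⟩ := h
  refine ⟨E, fun k => ?_⟩
  have := hE k
  simp only at this
  rw [← Finset.add_sum_erase _ _ (Finset.mem_univ c.1),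
    ← Finset.add_sum_erase _ _ (Finset.mem_univ c.1), hwall, hwall, hself,
    Finset.sum_congr rfl fun b hb => congrFun (hne b hb) k] at this
  omega

end Whitehead

/-! ### Pruning almost invariant sets -/

namespace Whitehead

open FreeGroup hiding map_mul map_one map_inv
open Filter

variable {α : Type*} [DecidableEq α]

/-- A set of vertices of the Cayley tree that contains `1` and is connected: closed under removing
the last letter of a reduced word. -/
def PrefixClosed (H : Finset (FreeGroup α)) : Prop :=
  1 ∈ H ∧ ∀ h ∈ H, ∀ x, h⁻¹ ∈ cyl x → h * letter x ∈ H

/-- Every edge of the Cayley tree separated by `X` has an endpoint in `H`. -/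
def ConstantOff (H : Finset (FreeGroup α)) (X : Set (FreeGroup α)) : Prop :=
  ∀ g z, g ∉ H → g * letter z ∉ H → (g ∈ X ↔ g * letter z ∈ X)

theorem norm_mul_letter_of_mem {h : FreeGroup α} {z : α × Bool} (hz : h⁻¹ ∈ cyl z) :
    h.norm = (h * letter z).norm + 1 := by
  obtain ⟨k, hk, e⟩ := exists_eq_letter_mul hz
  have e' : h = k⁻¹ * letter (bar z) := by
    rw [letter_bar, ← mul_inv_rev, ← e, inv_inv]
  have : h * letter z = k⁻¹ := by
    rw [e', mul_assoc, letter_bar_mul_letter, mul_one]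
  rw [this, e', norm_mul_letter (by simpa using hk)]

/-- A set that is constant off a connected set `H` is constant on every branch outside `H`. -/
theorem ConstantOff.branch {H : Finset (FreeGroup α)} {X : Set (FreeGroup α)}
    (hX : ConstantOff H X) (hH : PrefixClosed H) {w : FreeGroup α} {z : α × Bool}
    (hz : w⁻¹ ∉ cyl z) (hwz : w * letter z ∉ H) {g : FreeGroup α} (hg : g ∈ cyl z) :
    w * g ∉ H ∧ (w * g ∈ X ↔ w * letter z ∈ X) := by
  induction g using reduced_induction_right with
  | one => simp at hg
  | snoc g x hgx ih =>
    by_cases hg1 : g = 1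
    · subst hg1
      rw [one_mul, letter_mem_cyl] at hg
      subst hg
      rw [one_mul]
      exact ⟨hwz, Iff.rfl⟩
    have hgz : g ∈ cyl z := by
      refine (mul_letter_mem_cyl_iff (by simp [hg1]) ?_).mp hg
      rintro ⟨rfl, rfl⟩
      rw [← letter_bar, letter_mem_cyl] at hgx
      exact hgx rfl
    obtain ⟨h1, h2⟩ := ih hgz
    have hcancel : (w * g)⁻¹ ∉ cyl x := by
      rw [mul_inv_rev, mem_cyl, toWord_mul_eq_append]
      · obtain h0 | ⟨y, hy⟩ := eq_one_or_exists_mem_cyl g⁻¹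
        · simp [hg1] at h0
        · have hyx : y ≠ x := fun h => hgx (h ▸ hy)
          rw [mem_cyl] at hy
          rw [List.head?_append, hy]
          simpa using hyx
      · intro y hy hy'
        rw [inv_inv] at hy
        exact hz (cyl_unique hgz hy ▸ hy')
    have h3 : w * (g * letter x) ∉ H := by
      intro h
      have := hH.2 _ h (bar x) (by
        rw [← mul_assoc, mul_inv_rev, ← letter_bar]
        exact letter_mul_mem_cyl (by simpa using hcancel))
      rw [mul_assoc, mul_assoc, letter_mul_letter_bar, mul_one] at this
      exact h1 this
    refine ⟨h3, ?_⟩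
    rw [← h2, hX (w * g) x h1 (by rwa [mul_assoc]), mul_assoc]

theorem toWord_letter_pow (x : α × Bool) (k : ℕ) :
    (letter x ^ k).toWord = List.replicate k x := by
  induction k with
  | zero => simp
  | succ k ih =>
    rw [pow_succ', toWord_letter_mul, ih, List.replicate_succ]
    rw [mem_cyl, ih]
    cases k with
    | zero => simp
    | succ k =>
      simp only [List.head?_replicate]
      simpa using (bar_ne x).symm

variable [Fintype α]

/-- One pruning step at a vertex `w` of `H` at maximal distance from `1`: the set `X` is made
constant, hence constant off a smaller set, on the part of the tree hanging off `w`. The new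
value is the one that `X` takes beyond `w` when the last letter of `w` is repeated; this is the
choice for which a cut inequality and submodularity show that crossings do not increase, and for
which the ends of the axes of letters keep their sides. -/
theorem WhiteheadMinimal.prune {U : List (FreeGroup α)} (hU : WhiteheadMinimal U)
    {H : Finset (FreeGroup α)} (hH : PrefixClosed H) {X : Set (FreeGroup α)}
    (hXai : AlmostInvariant X) (hX : ConstantOff H X) {w : FreeGroup α} (hw : w ∈ H)
    (hw1 : w ≠ 1) (hmax : ∀ h ∈ H, h.norm ≤ w.norm) :
    PrefixClosed (H.erase w) ∧ ∃ X' : Set (FreeGroup α), AlmostInvariant X' ∧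
      ConstantOff (H.erase w) X' ∧ CoarseLE (crossPow U X') (crossPow U X) ∧
      ∀ x, ∀ᶠ k in atTop, (letter x ^ k ∈ X' ↔ letter x ^ k ∈ X) := by
  classical
  refine ⟨⟨Finset.mem_erase.mpr ⟨hw1.symm, hH.1⟩, ?_⟩, ?_⟩
  · intro h hh x hx
    rw [Finset.mem_erase] at hh ⊢
    refine ⟨?_, hH.2 h hh.2 x hx⟩
    intro e
    have h1 := norm_mul_letter_of_mem hx
    have h2 := hmax h hh.2
    rw [e] at h1
    omega
  obtain ⟨v, hv⟩ : ∃ v, w⁻¹ ∈ cyl v := by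
    rcases eq_one_or_exists_mem_cyl w⁻¹ with h | h
    · simp [hw1] at h
    · exact h
  have hout : ∀ z, z ≠ v → w⁻¹ ∉ cyl z ∧ w * letter z ∉ H := by
    intro z hz
    have hz' : w⁻¹ ∉ cyl z := fun h => hz (cyl_unique h hv)
    refine ⟨hz', fun h => ?_⟩
    have h1 := hmax _ h
    rw [norm_mul_letter hz'] at h1
    omega
  wlog hcol : w * letter (bar v) ∉ X generalizing X with key
  · obtain ⟨X', h1, h2, h3, h4⟩ := key hXai.compl
      (fun g z hg hgz => not_congr (hX g z hg hgz)) (by simpa using hcol)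
    refine ⟨X'ᶜ, h1.compl, fun g z hg hgz => not_congr (h2 g z hg hgz), ?_, ?_⟩
    · rwa [crossPow_compl, ← crossPow_compl U X]
    · intro x
      filter_upwards [h4 x] with k hk
      rw [Set.mem_compl_iff, hk, Set.mem_compl_iff, not_not]
  set Y : Set (FreeGroup α) := (w⁻¹ * ·) ⁻¹' cyl v with hY
  have hYai : AlmostInvariant Y := (almostInvariant_cyl v).translate _
  have hwY : w ∉ Y := by simp [hY]
  refine ⟨X ∩ Y, hXai.inter hYai, ?_, ?_, ?_⟩
  · -- the edges at `w` leading away from `1` lie outside `Y`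
    have hedge : ∀ z, w * letter z ∉ H.erase w → w * letter z ∉ Y := by
      intro z hz
      simp only [hY, Set.mem_preimage, inv_mul_cancel_left, letter_mem_cyl]
      rintro rfl
      refine hz (Finset.mem_erase.mpr ⟨?_, hH.2 w hw z hv⟩)
      intro e
      have h := norm_mul_letter_of_mem hv
      rw [e] at h
      omega
    intro g z hg hgz
    by_cases h1 : g = w
    · subst h1
      exact iff_of_false (fun h => hwY h.2) (fun h => hedge z hgz h.2)
    by_cases h2 : g * letter z = w
    · have e : g = w * letter (bar z) := by
        rw [← h2, mul_assoc, letter_mul_letter_bar, mul_one]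
      refine iff_of_false (fun h => ?_) (fun h => hwY (h2 ▸ h.2))
      rw [e] at hg h
      exact hedge _ hg h.2
    · have h3 := hX g z (fun h => hg (Finset.mem_erase.mpr ⟨h1, h⟩))
        (fun h => hgz (Finset.mem_erase.mpr ⟨h2, h⟩))
      have h4 : w⁻¹ * (g * letter z) ∈ cyl v ↔ w⁻¹ * g ∈ cyl v := by
        rw [← mul_assoc]
        refine mul_letter_mem_cyl_iff ?_ ?_
        · rintro ⟨h, -⟩
          exact h1 (inv_mul_eq_one.mp h).symm
        · rintro ⟨h, rfl⟩
          apply h2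
          rw [inv_mul_eq_iff_eq_mul.mp h, mul_assoc, letter_mul_letter_bar, mul_one]
      simp only [Set.mem_inter_iff, hY, Set.mem_preimage, h3, h4]
  · set A : Finset (α × Bool) :=
      insert v (Finset.univ.filter fun z => z ≠ v ∧ w * letter z ∈ X) with hA
    have hvA : v ∈ A := Finset.mem_insert_self _ _
    have hvA' : bar v ∉ A := by simp [hA, bar_ne, hcol]
    have h1 : CoarseLE (crossPow U Y) (crossPow U ((w⁻¹ * ·) ⁻¹' cylSet A)) := by
      rw [hY, crossPow_translate, crossPow_translate]
      exact hU.crossPow_cyl_le hvA hvA'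
    have h2 : CoarseLE (crossPow U ((w⁻¹ * ·) ⁻¹' cylSet A)) (crossPow U (X ∪ Y)) := by
      refine crossPow_coarseLE_of_agree_off (hXai.union hYai) (Set.finite_singleton w) ?_ U
      intro g hg
      rcases eq_one_or_exists_mem_cyl (w⁻¹ * g) with h | ⟨z, hz⟩
      · exact absurd (inv_mul_eq_one.mp h).symm hg
      have hzA : g ∈ (w⁻¹ * ·) ⁻¹' cylSet A ↔ z ∈ A :=
        ⟨fun ⟨y, hy, hy'⟩ => cyl_unique hy' hz ▸ hy, fun h => ⟨z, h, hz⟩⟩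
      have hzY : g ∈ Y ↔ z = v := ⟨fun h => cyl_unique hz h, by rintro rfl; exact hz⟩
      rw [hzA, Set.mem_union, hzY]
      by_cases hzv : z = v
      · simp [hzv, hvA]
      · have := (hX.branch hH (hout z hzv).1 (hout z hzv).2 hz).2
        rw [mul_inv_cancel_left] at this
        simp [hA, hzv, this]
    obtain ⟨E, hE⟩ := h1.trans h2
    refine ⟨E, fun k => ?_⟩
    have h3 := crossPow_inter_add_union_le hXai hYai U k
    have h4 := hE k
    omega
  · intro x
    filter_upwards [eventually_gt_atTop w.norm] with k hk
    rw [Set.mem_inter_iff, and_iff_left_iff_imp]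
    intro hkX
    by_contra hkY
    -- the axis of `x` leaves the vertex `w` through its last letter, which must be `x`
    set h := w⁻¹ * letter x ^ k with hh
    have e : letter x ^ k = w * h := by rw [hh, mul_inv_cancel_left]
    have hword : List.replicate k x = w.toWord ++ h.toWord := by
      rw [← toWord_letter_pow, e]
      refine toWord_mul_eq_append fun y hy hy' => hkY ?_
      rw [← cyl_unique hv hy] at hy'
      exact hy'
    have hvx : bar v = x := by
      have h1 : v ∈ invRev w.toWord := by
        rw [← toWord_inv]; exact List.mem_of_mem_head? hv
      have h2 : bar v ∈ w.toWord := by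
        simp only [invRev, List.mem_reverse, List.mem_map] at h1
        obtain ⟨y, hy, rfl⟩ := h1
        simpa [bar] using hy
      exact List.eq_of_mem_replicate (n := k) (by rw [hword]; simp [h2])
    have hhx : h ∈ cyl x := by
      rcases eq_one_or_exists_mem_cyl h with h0 | ⟨y, hy⟩
      · have := congrArg List.length hword
        simp only [h0, toWord_one, List.append_nil, List.length_replicate] at this
        rw [FreeGroup.norm, ← this] at hk
        exact absurd hk (lt_irrefl _)
      · have : y = x := List.eq_of_mem_replicate (n := k) (by
          rw [hword]; exact List.mem_append_right _ (List.mem_of_mem_head? hy))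
        exact this ▸ hy
    subst hvx
    have := (hX.branch hH (hout _ (bar_ne v)).1 (hout _ (bar_ne v)).2 hhx).2
    rw [← e] at this
    exact hcol (this.mp hkX)

/-- In a Whitehead minimal position, a set separating the two ends of the axis of a letter `x`
is crossed at least as often as the wall of `x`. -/
theorem WhiteheadMinimal.crossPow_cyl_le_of_separates {U : List (FreeGroup α)}
    (hU : WhiteheadMinimal U) {H : Finset (FreeGroup α)} (hH : PrefixClosed H)
    {X : Set (FreeGroup α)} (hXai : AlmostInvariant X) (hX : ConstantOff H X) {x : α × Bool}
    (h1 : ∀ᶠ k in atTop, letter x ^ k ∈ X) (h2 : ∀ᶠ k in atTop, letter (bar x) ^ k ∉ X) :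
    CoarseLE (crossPow U (cyl x)) (crossPow U X) := by
  classical
  induction hn : H.card generalizing H X with
  | zero => exact absurd (Finset.card_eq_zero.mp hn ▸ hH.1) (Finset.notMem_empty _)
  | succ n ih =>
    obtain ⟨w, hw, hmax⟩ := Finset.exists_max_image H (FreeGroup.norm (α := α)) ⟨1, hH.1⟩
    by_cases hw1 : w = 1
    · have hH1 : ∀ h ∈ H, h = 1 := fun h hh => by
        have := hmax h hh
        rw [hw1, FreeGroup.norm_one, Nat.le_zero, FreeGroup.norm_eq_zero] at this
        exact this
      have hbr : ∀ z g, g ∈ cyl z → (g ∈ X ↔ letter z ∈ X) := by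
        intro z g hg
        have hz : (1 : FreeGroup α) * letter z ∉ H := fun h => by
          have := hH1 _ h
          rw [one_mul] at this
          have h' : letter z ∈ cyl z := letter_mem_cyl.mpr rfl
          simp [this] at h'
        have := (hX.branch hH (by simp) hz hg).2
        rwa [one_mul, one_mul] at this
      have hpow : ∀ (z : α × Bool) (k : ℕ), 0 < k → letter z ^ k ∈ cyl z := by
        intro z k hk
        rw [mem_cyl, toWord_letter_pow, List.head?_replicate, if_neg hk.ne']
      set A : Finset (α × Bool) := Finset.univ.filter fun z => letter z ∈ X with hA
      have hxA : x ∈ A := by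
        obtain ⟨k, hk, hk'⟩ := (h1.and (eventually_gt_atTop 0)).exists
        simpa [hA] using (hbr x _ (hpow x k hk')).mp hk
      have hxA' : bar x ∉ A := by
        obtain ⟨k, hk, hk'⟩ := (h2.and (eventually_gt_atTop 0)).exists
        simpa [hA] using fun h => hk ((hbr _ _ (hpow _ k hk')).mpr h)
      refine (hU.crossPow_cyl_le hxA hxA').trans
        (crossPow_coarseLE_of_agree_off hXai (Set.finite_singleton 1) ?_ U)
      intro g hg
      rcases eq_one_or_exists_mem_cyl g with rfl | ⟨z, hz⟩
      · exact absurd rfl hg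
      rw [hbr z g hz]
      constructor
      · rintro ⟨y, hy, hgy⟩
        rw [cyl_unique hz hgy]
        simpa [hA] using hy
      · intro h
        exact ⟨z, by simpa [hA] using h, hz⟩
    · obtain ⟨hH', X', hX'ai, hX', hle, hends⟩ := hU.prune hH hXai hX hw hw1 hmax
      refine (ih hH' hX'ai hX' ?_ ?_ ?_).trans hle
      · filter_upwards [h1, hends x] with k hk hk'
        exact hk'.mpr hk
      · filter_upwards [h2, hends (bar x)] with k hk hk'
        exact fun h => hk (hk'.mp h)
      · rw [Finset.card_erase_of_mem hw, hn, Nat.add_sub_cancel]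

theorem finite_norm_le (n : ℕ) : {g : FreeGroup α | g.norm ≤ n}.Finite :=
  (List.finite_length_le (α × Bool) n).preimage (toWord_injective (α := α)).injOn

theorem AlmostInvariant.exists_constantOff {X : Set (FreeGroup α)} (hX : AlmostInvariant X) :
    ∃ H : Finset (FreeGroup α), PrefixClosed H ∧ ConstantOff H X := by
  have hB : (⋃ z, bd (letter z) X).Finite := Set.finite_iUnion fun z => hX (letter z)
  obtain ⟨n, hn⟩ := (hB.image (FreeGroup.norm (α := α))).bddAbove
  refine ⟨(finite_norm_le n).toFinset, ⟨by simp, ?_⟩, ?_⟩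
  · intro h hh x hx
    have := norm_mul_letter_of_mem hx
    simp only [Set.Finite.mem_toFinset, Set.mem_ofPred_eq] at hh ⊢
    omega
  · intro g z hg _
    by_contra hc
    refine hg ?_
    simp only [Set.Finite.mem_toFinset, Set.mem_ofPred_eq]
    exact hn (Set.mem_image_of_mem _ (Set.mem_iUnion.mpr ⟨z, hc⟩))

end Whitehead

/-! ### Whitehead minimal positions are minimal -/

namespace Whitehead

open FreeGroup hiding map_mul map_one map_inv
open Filter

/-- A sequence of truth values that changes only finitely often is eventually constant at both
ends. -/
theorem eventually_const_of_finite_changes {p : ℤ → Prop} (h : {j | ¬(p j ↔ p (j + 1))}.Finite) :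
    ((∀ᶠ j : ℤ in atTop, p j) ∨ ∀ᶠ j : ℤ in atTop, ¬p j) ∧
      ((∀ᶠ j : ℤ in atBot, p j) ∨ ∀ᶠ j : ℤ in atBot, ¬p j) := by
  obtain ⟨b, hb⟩ := h.bddAbove
  obtain ⟨c, hc⟩ := h.bddBelow
  have up : ∀ j, b + 1 ≤ j → (p j ↔ p (b + 1)) := by
    intro j hj
    induction j, hj using Int.leInduction with
    | base => exact Iff.rfl
    | succ j hj ih =>
      rw [← ih]
      by_contra hn
      have : j ≤ b := hb (fun h => hn h.symm)
      omega
  have dn : ∀ j, j ≤ c - 1 → (p j ↔ p (c - 1)) := by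
    intro j hj
    induction j, hj using Int.leInductionDown with
    | base => exact Iff.rfl
    | pred j hj ih =>
      rw [← ih]
      by_contra hn
      have : c ≤ j - 1 := hc (by simpa using hn)
      omega
  constructor
  · by_cases hp : p (b + 1)
    · left; filter_upwards [eventually_ge_atTop (b + 1)] with j hj using (up j hj).mpr hp
    · right; filter_upwards [eventually_ge_atTop (b + 1)] with j hj using fun h => hp ((up j hj).mp h)
  · by_cases hp : p (c - 1)
    · left; filter_upwards [eventually_le_atBot (c - 1)] with j hj using (dn j hj).mpr hp
    · right; filter_upwards [eventually_le_atBot (c - 1)] with j hj using fun h => hp ((dn j hj).mp h)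

/-- If an almost invariant set separates the ends of no translate of the axis of `t`, then it is
crossed boundedly often by the powers of `t`. -/
theorem cross_pow_bounded {G : Type*} [Group G] {t : G}
    (ht : Function.Injective fun j : ℤ => t ^ j) {X : Set G} (hX : AlmostInvariant X)
    (h1 : ∀ g, ¬((∀ᶠ j : ℤ in atTop, g * t ^ j ∈ X) ∧ ∀ᶠ j : ℤ in atBot, g * t ^ j ∉ X))
    (h2 : ∀ g, ¬((∀ᶠ j : ℤ in atTop, g * t ^ j ∉ X) ∧ ∀ᶠ j : ℤ in atBot, g * t ^ j ∈ X)) :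
    ∃ E, ∀ k : ℕ, cross (t ^ k) X ≤ E := by
  have hinj : ∀ g : G, Function.Injective fun j : ℤ => g * t ^ j :=
    fun g => (mul_right_injective g).comp ht
  -- each line has a common side of its two ends
  have side : ∀ g, ∃ c : Prop, {j : ℤ | ¬(g * t ^ j ∈ X ↔ c)}.Finite := by
    intro g
    have hfin : {j : ℤ | ¬(g * t ^ j ∈ X ↔ g * t ^ (j + 1) ∈ X)}.Finite := by
      refine ((hX t).preimage (hinj g).injOn).subset fun j hj => ?_
      have hj' : ¬(g * t ^ j ∈ X ↔ g * t ^ (j + 1) ∈ X) := hj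
      rwa [zpow_add_one, ← mul_assoc] at hj'
    have hcof : ∀ c : Prop, (∀ᶠ j : ℤ in atTop, (g * t ^ j ∈ X ↔ c)) →
        (∀ᶠ j : ℤ in atBot, (g * t ^ j ∈ X ↔ c)) → {j : ℤ | ¬(g * t ^ j ∈ X ↔ c)}.Finite := by
      intro c ha hb
      have : ∀ᶠ j : ℤ in cofinite, (g * t ^ j ∈ X ↔ c) := by
        rw [Int.cofinite_eq]; exact eventually_sup.mpr ⟨hb, ha⟩
      exact this
    obtain ⟨ha | ha, hb | hb⟩ := eventually_const_of_finite_changes hfin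
    · exact ⟨True, hcof _ (by simpa using ha) (by simpa using hb)⟩
    · exact absurd ⟨ha, hb⟩ (h1 g)
    · exact absurd ⟨ha, hb⟩ (h2 g)
    · exact ⟨False, hcof _ (by simpa using ha) (by simpa using hb)⟩
  choose c hc using side
  set T : Set G := ⋃ e ∈ bd t X, (fun j : ℤ => e * t ^ j) '' {j : ℤ | ¬(e * t ^ j ∈ X ↔ c e)}
    with hT
  have hTfin : T.Finite := (hX t).biUnion fun e _ => (hc e).image _
  refine ⟨2 * T.ncard, fun k => ?_⟩
  have hsub : bd (t ^ k) X ⊆ T ∪ (· * t ^ k) ⁻¹' T := by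
    intro h hh
    obtain ⟨j, hj⟩ : ∃ j : ℤ, h * t ^ j ∈ bd t X := by
      by_contra! hno
      apply hh
      clear hh
      induction k with
      | zero => simp
      | succ k ih =>
        have := hno k
        rw [mem_bd, not_not, zpow_natCast] at this
        rw [ih, this, pow_succ, ← mul_assoc]
    set e := h * t ^ j with he
    have e1 : h = e * t ^ (-j) := by rw [he, mul_assoc, ← zpow_add]; simp
    have e2 : h * t ^ k = e * t ^ ((k : ℤ) - j) := by
      rw [he, mul_assoc, ← zpow_add, ← zpow_natCast]; simp
    by_cases hs : h ∈ X ↔ c e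
    · right
      refine Set.mem_biUnion hj ⟨(k : ℤ) - j, ?_, e2.symm⟩
      intro h0
      rw [← e2] at h0
      exact hh (hs.trans h0.symm)
    · left
      refine Set.mem_biUnion hj ⟨-j, ?_, e1.symm⟩
      intro h0
      rw [← e1] at h0
      exact hs h0
  have e : ((· * t ^ k) ⁻¹' T).ncard = T.ncard :=
    Set.ncard_preimage_of_injective_subset_range (mul_left_injective _)
      (by rw [(Group.mulRight_bijective _).surjective.range_eq]; exact Set.subset_univ _)
  calc cross (t ^ k) X ≤ (T ∪ (· * t ^ k) ⁻¹' T).ncard :=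
        Set.ncard_le_ncard hsub (hTfin.union (hTfin.preimage (mul_left_injective _).injOn))
    _ ≤ 2 * T.ncard := by by_contra! hlt; have := Set.ncard_union_le T ((· * t ^ k) ⁻¹' T); omega

variable {α : Type*} [DecidableEq α]

/-- The exponent sum of the generator `b`. -/
def expSum (b : α) : FreeGroup α →* Multiplicative ℤ :=
  FreeGroup.lift fun i => Multiplicative.ofAdd (if i = b then 1 else 0)

theorem expSum_of (b i : α) : (expSum b (of i)).toAdd = if i = b then 1 else 0 := by
  simp [expSum]

theorem abs_expSum_le (b : α) (g : FreeGroup α) :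
    |(expSum b g).toAdd| ≤ cross g (cyl (b, true)) := by
  induction g using reduced_induction_right with
  | one => simp
  | snoc g z hg ih =>
    have h1 : |(expSum b (letter z)).toAdd| ≤ if z.1 = b then 1 else 0 := by
      obtain ⟨i, _ | _⟩ := z
      · rw [letter_false, map_inv, toAdd_inv, expSum_of]; split_ifs <;> simp
      · rw [letter_true, expSum_of]; split_ifs <;> simp
    rw [cross_mul_letter hg, map_mul, toAdd_mul]
    refine (abs_add_le _ _).trans ?_
    push_cast
    exact add_le_add ih h1

variable [Fintype α]

theorem expSum_comp (f : MulAut (FreeGroup α)) (b : α) (g : FreeGroup α) :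
    (expSum b (f g)).toAdd = ∑ i, (expSum i g).toAdd * (expSum b (f (of i))).toAdd := by
  induction g using FreeGroup.induction_on with
  | C1 => simp
  | of i => simp [expSum_of]
  | inv_of i _ => simp [expSum_of]
  | mul x y hx hy => simp only [map_mul, toAdd_mul, hx, hy, add_mul, Finset.sum_add_distrib]

/-- The abelianization of an automorphism is invertible, so some permutation of the basis picks
nonzero exponent sums. -/
theorem exists_perm_expSum_ne_zero (f : MulAut (FreeGroup α)) :
    ∃ σ : Equiv.Perm α, ∀ a, (expSum (σ a) (f (of a))).toAdd ≠ 0 := by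
  let M : MulAut (FreeGroup α) → Matrix α α ℤ := fun f =>
    Matrix.of fun a b => (expSum b (f (of a))).toAdd
  have hM : M f⁻¹ * M f = 1 := by
    ext a b
    have := expSum_comp f b (f⁻¹ (of a))
    rw [MulAut.apply_inv_self, expSum_of] at this
    simp only [M, Matrix.mul_apply, Matrix.of_apply, Matrix.one_apply, ← this]
  have hdet : (M f).det ≠ 0 := by
    intro h
    have := congrArg Matrix.det hM
    rw [Matrix.det_mul, h, mul_zero, Matrix.det_one] at this
    exact zero_ne_one this
  rw [← Matrix.det_transpose, Matrix.det_apply] at hdet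
  obtain ⟨σ, -, hσ⟩ := Finset.exists_ne_zero_of_sum_ne_zero hdet
  refine ⟨σ, fun a h => hσ ?_⟩
  rw [Finset.prod_eq_zero (Finset.mem_univ a), smul_zero]
  exact h

/-- A wall of another basis which the letter `a` crosses with nonzero exponent sum is crossed by
a Whitehead minimal list at least as often as the wall of `a`, since some translate of it separates
the ends of the axis of `a`. -/
theorem WhiteheadMinimal.crossPow_cyl_le_comap {U : List (FreeGroup α)} (hU : WhiteheadMinimal U)
    (f : MulAut (FreeGroup α)) {a b : α} (hab : (expSum b (f (of a))).toAdd ≠ 0) :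
    CoarseLE (crossPow U (cyl (a, true))) (crossPow U (f ⁻¹' cyl (b, true))) := by
  set X : Set (FreeGroup α) := f ⁻¹' cyl (b, true) with hXdef
  have hX : AlmostInvariant X := (almostInvariant_cyl _).comap f
  have hinj : Function.Injective fun j : ℤ => (of a : FreeGroup α) ^ j := by
    rw [injective_zpow_iff_not_isOfFinOrder, isOfFinOrder_iff_pow_eq_one]
    rintro ⟨n, hn, h⟩
    have := congrArg FreeGroup.norm h
    rw [norm_of_pow, FreeGroup.norm_one] at this
    omega
  have key : ∀ g (x : α × Bool), x.1 = a → (∀ᶠ k : ℕ in atTop, g * letter x ^ k ∈ X) →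
      (∀ᶠ k : ℕ in atTop, g * letter (bar x) ^ k ∉ X) →
      CoarseLE (crossPow U (cyl (a, true))) (crossPow U X) := by
    rintro g x rfl h1 h2
    have hgX := hX.translate g
    obtain ⟨H, hH, hHX⟩ := hgX.exists_constantOff
    have := hU.crossPow_cyl_le_of_separates hH hgX hHX h1 h2
    rw [crossPow_translate] at this
    obtain ⟨i, _ | _⟩ := x
    · rw [← crossPow_cyl_bar]; exact this
    · exact this
  have hpos : ∀ k : ℕ, ((of a : FreeGroup α) ^ (k : ℤ)) = letter (a, true) ^ k := fun k => by
    rw [zpow_natCast, letter_true]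
  have hneg : ∀ k : ℕ, ((of a : FreeGroup α) ^ (-(k : ℤ))) = letter (a, false) ^ k := fun k => by
    rw [zpow_neg, zpow_natCast, letter_false, inv_pow]
  have hbot : Tendsto (fun k : ℕ => -(k : ℤ)) atTop atBot :=
    tendsto_neg_atTop_atBot.comp tendsto_natCast_atTop_atTop
  by_contra hno
  obtain ⟨E, hE⟩ := cross_pow_bounded hinj hX
    (fun g ⟨h1, h2⟩ => hno (key g (a, true) rfl
      ((tendsto_natCast_atTop_atTop.eventually h1).mono fun k hk => by rwa [hpos] at hk)
      ((hbot.eventually h2).mono fun k hk => by rwa [hneg] at hk)))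
    (fun g ⟨h1, h2⟩ => hno (key g (a, false) rfl
      ((hbot.eventually h2).mono fun k hk => by rwa [hneg] at hk)
      ((tendsto_natCast_atTop_atTop.eventually h1).mono fun k hk => by rwa [hpos] at hk)))
  have h1 := hE (E + 1)
  have h2 := abs_expSum_le b (f (of a ^ (E + 1)))
  rw [hXdef, cross_comap] at h1
  rw [map_pow, map_pow, toAdd_pow, nsmul_eq_mul, abs_mul] at h2
  rw [map_pow] at h1
  have h3 : 1 ≤ |(expSum b (f (of a))).toAdd| := Int.one_le_abs hab
  have h4 : |((E + 1 : ℕ) : ℤ)| = E + 1 := by rw [abs_of_nonneg (by positivity)]; push_cast; ring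
  rw [h4] at h2
  have h5 : (cross ((f (of a)) ^ (E + 1)) (cyl (b, true)) : ℤ) ≤ E := by exact_mod_cast h1
  nlinarith

/-- If no Whitehead automorphism shortens `U`, then no automorphism does. -/
theorem WhiteheadMinimal.totalLength_le {U : List (FreeGroup α)} (hU : WhiteheadMinimal U)
    (f : MulAut (FreeGroup α)) : totalLength U ≤ totalLength (U.map f) := by
  obtain ⟨σ, hσ⟩ := exists_perm_expSum_ne_zero f
  refine CoarseLE.le_of_mul ((totalLength_coarseLE U).trans (CoarseLE.trans ?_
    (coarseLE_totalLength (U.map f))))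
  have h := CoarseLE.sum Finset.univ fun a _ => hU.crossPow_cyl_le_comap f (hσ a)
  simp only [crossPow_comap] at h
  obtain ⟨E, hE⟩ := h
  refine ⟨E, fun k => (hE k).trans_eq ?_⟩
  exact congrArg (· + E) (Equiv.sum_comp σ fun b => crossPow (U.map f) (cyl (b, true)) k)

end Whitehead

/-! ### Outer automorphisms that keep short test words short -/

namespace Whitehead

open FreeGroup hiding map_mul map_one map_inv

variable {α : Type*} [DecidableEq α]

theorem mul_mem_cyl {g h : FreeGroup α} {x : α × Bool} (hg : g ∈ cyl x)
    (H : ∀ y, g⁻¹ ∈ cyl y → h ∉ cyl y) : g * h ∈ cyl x := by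
  rw [mem_cyl] at hg
  rw [mem_cyl, toWord_mul_eq_append H, List.head?_append, hg]
  rfl

theorem norm_mul_eq_add {g h : FreeGroup α} (H : ∀ y, g⁻¹ ∈ cyl y → h ∉ cyl y) :
    (g * h).norm = g.norm + h.norm := by
  rw [FreeGroup.norm, toWord_mul_eq_append H, List.length_append]; rfl

theorem cyclicLength_le_norm (g : FreeGroup α) : cyclicLength g ≤ g.norm := by
  have := mul_cyclicLength_le g 1
  rwa [one_mul, pow_one] at this

theorem cyclicLength_eq_norm {g : FreeGroup α} (H : ∀ y, g⁻¹ ∈ cyl y → g ∉ cyl y) :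
    cyclicLength g = g.norm := by
  have h1 := norm_pow_eq_cyclicLength g 0
  have h2 := norm_pow_eq_cyclicLength g 1
  rw [zero_add, pow_one] at h1
  rw [one_add_one_eq_two, pow_two, norm_mul_eq_add H] at h2
  omega

theorem cyclicLength_conj (g h : FreeGroup α) : cyclicLength (h * g * h⁻¹) = cyclicLength g :=
  (cyclicLength_eq_of_isConj (isConj_iff.mpr ⟨h, rfl⟩)).symm

/-- A product of `of i` and a conjugate of `of j` has cyclic length at most `2` only if the axes of
the two factors meet; the conjugator is then a translation along one axis followed by a translation
along the other. -/
theorem eq_zpow_mul_zpow_of_cyclicLength_le {i j : α} (g : FreeGroup α)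
    (h : cyclicLength (of i * (g * of j * g⁻¹)) ≤ 2) :
    ∃ k m : ℤ, g = of i ^ k * of j ^ m := by
  induction hn : g.norm using Nat.strong_induction_on generalizing g with
  | _ n ih =>
  subst hn
  by_cases hg1 : g = 1
  · exact ⟨0, 0, by simp [hg1]⟩
  obtain ⟨x, hx⟩ := (eq_one_or_exists_mem_cyl g).resolve_left hg1
  obtain ⟨y, hy⟩ := (eq_one_or_exists_mem_cyl g⁻¹).resolve_left (by simpa using hg1)
  have hpow : ∀ z : α × Bool, ∃ e : ℤ, letter z = of z.1 ^ e := by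
    rintro ⟨a, _ | _⟩
    · exact ⟨-1, by rw [zpow_neg_one]; rfl⟩
    · exact ⟨1, by rw [zpow_one]; rfl⟩
  by_cases hxi : x.1 = i
  · obtain ⟨g', hg', rfl⟩ := exists_eq_letter_mul hx
    obtain ⟨e, he⟩ := hpow x
    rw [hxi] at he
    obtain ⟨k, m, hkm⟩ := ih g'.norm (by simp [FreeGroup.norm, toWord_letter_mul hg']) g' (by
      rw [← cyclicLength_conj _ (letter x)]
      convert h using 2
      have hc : letter x * of i = of i * letter x := by
        rw [he]; exact ((Commute.refl (of i)).zpow_left e).eq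
      rw [mul_inv_rev]
      simp only [← mul_assoc, hc]) rfl
    exact ⟨e + k, m, by rw [hkm, he, zpow_add, mul_assoc]⟩
  by_cases hyj : y.1 = j
  · obtain ⟨k, hk, hgk⟩ := exists_eq_letter_mul hy
    obtain ⟨e, he⟩ := hpow (bar y)
    rw [bar_fst, hyj] at he
    have hg : g = k⁻¹ * letter (bar y) := by rw [letter_bar, ← mul_inv_rev, ← hgk, inv_inv]
    have hc : letter (bar y) * of j * (letter (bar y))⁻¹ = of j := by
      rw [he, ((Commute.refl (of j)).zpow_left e).eq, mul_inv_cancel_right]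
    obtain ⟨k', m, hkm⟩ := ih (k⁻¹).norm (by
      rw [norm_inv_eq, ← norm_inv_eq (x := g), hgk]; simp [FreeGroup.norm, toWord_letter_mul hk])
      k⁻¹ (by
        convert h using 2
        nth_rewrite 1 [← hc]
        rw [hg, mul_inv_rev]
        simp only [mul_assoc]) rfl
    exact ⟨k', m + e, by rw [hg, hkm, he, zpow_add, mul_assoc]⟩
  -- otherwise the product is cyclically reduced as written
  exfalso
  have e1 : letter (j, true) * g⁻¹ ∈ cyl (j, true) :=
    letter_mul_mem_cyl fun hf => hyj (by rw [cyl_unique hy hf]; rfl)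
  have c1 : ∀ z, (letter (j, true))⁻¹ ∈ cyl z → g⁻¹ ∉ cyl z := by
    intro z hz hz'
    rw [← letter_bar, letter_mem_cyl] at hz
    exact hyj (by rw [cyl_unique hy hz', ← hz]; rfl)
  have c2 : ∀ z, g⁻¹ ∈ cyl z → letter (j, true) * g⁻¹ ∉ cyl z := by
    intro z hz hz'
    exact hyj (by rw [cyl_unique hy hz, ← cyl_unique e1 hz'])
  have e2 : g * (letter (j, true) * g⁻¹) ∈ cyl x := mul_mem_cyl hx c2
  have c3 : ∀ z, (letter (i, true))⁻¹ ∈ cyl z → g * (letter (j, true) * g⁻¹) ∉ cyl z := by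
    intro z hz hz'
    rw [← letter_bar, letter_mem_cyl] at hz
    exact hxi (by rw [cyl_unique e2 hz', ← hz]; rfl)
  have e3 : letter (i, true) * (g * (letter (j, true) * g⁻¹)) ∈ cyl (i, true) :=
    mul_mem_cyl (by simp) c3
  have e4 : g⁻¹ * letter (i, false) ∈ cyl y := by
    refine mul_mem_cyl hy fun z hz hz' => ?_
    rw [inv_inv] at hz
    rw [letter_mem_cyl] at hz'
    exact hxi (by rw [cyl_unique hx hz, ← hz'])
  have e5 : letter (j, false) * (g⁻¹ * letter (i, false)) ∈ cyl (j, false) :=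
    letter_mul_mem_cyl fun hf => hyj (by rw [cyl_unique e4 hf]; rfl)
  have e6 : (letter (i, true) * (g * (letter (j, true) * g⁻¹)))⁻¹ ∈ cyl x := by
    have : (letter (i, true) * (g * (letter (j, true) * g⁻¹)))⁻¹ =
        g * (letter (j, false) * (g⁻¹ * letter (i, false))) := by
      simp only [letter_true, letter_false, mul_inv_rev, inv_inv, mul_assoc]
    rw [this]
    refine mul_mem_cyl hx fun z hz hz' => ?_
    exact hyj (by rw [cyl_unique hy hz, ← cyl_unique e5 hz'])
  have hlen := cyclicLength_eq_norm (g := letter (i, true) * (g * (letter (j, true) * g⁻¹)))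
    fun z hz hz' => hxi (by rw [cyl_unique e6 hz, ← cyl_unique e3 hz'])
  rw [norm_mul_eq_add c3, norm_mul_eq_add c2, norm_mul_eq_add c1, norm_inv_eq] at hlen
  have hg0 : g.norm ≠ 0 := fun hf => hg1 (FreeGroup.norm_eq_zero.mp hf)
  have hl : ∀ z : α × Bool, (letter z).norm = 1 := fun z => by simp [FreeGroup.norm]
  rw [hl, hl] at hlen
  rw [letter_true, letter_true, ← mul_assoc g] at hlen
  omega

theorem zpow_eq_zero_of_conj_eq {a b c : α} (hac : a ≠ c) (hba : b ≠ a) (hbc : b ≠ c) {k l : ℤ}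
    (h : of a ^ k * of c * (of a ^ k)⁻¹ = of b ^ l * of c * (of b ^ l)⁻¹) : k = 0 := by
  -- let `a` act on `ℚ` by doubling, `c` by adding one, and `b` trivially
  let two : ℚˣ := Units.mk0 2 two_ne_zero
  let F : FreeGroup α →* Equiv.Perm ℚ := FreeGroup.lift fun i =>
    if i = a then MulAction.toPermHom ℚˣ ℚ two else if i = c then Equiv.addRight 1 else 1
  have ha : F (of a) = MulAction.toPermHom ℚˣ ℚ two := by simp [F]
  have hb : F (of b) = 1 := by simp [F, hba, hbc]
  have hc : F (of c) = Equiv.addRight 1 := by simp [F, hac.symm]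
  have h1 := congrArg (fun g => F g 0) h
  simp only [map_mul, map_inv, map_zpow, ha, hb, hc, one_zpow, inv_one, mul_one, one_mul] at h1
  rw [← map_zpow, ← map_inv] at h1
  have h2 : (2 : ℚ) ^ k = 1 := by
    simpa [Equiv.Perm.mul_apply, Units.smul_def, two] using h1
  exact (zpow_eq_one_iff_right₀ (by norm_num) (by norm_num)).mp h2

/-- The test words: generators and products of two generators. -/
def testWord : α ⊕ α × α → FreeGroup α
  | Sum.inl i => of i
  | Sum.inr (i, j) => of i * of j

/-- An automorphism preserving the conjugacy classes of the test words is inner. -/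
theorem inner_of_isConj_testWord [Nontrivial α] {f : MulAut (FreeGroup α)}
    (hf : ∀ w : α ⊕ α × α, IsConj (testWord w) (f (testWord w))) :
    f ∈ (MulAut.conj : FreeGroup α →* MulAut (FreeGroup α)).range := by
  obtain ⟨a, b, hab⟩ := exists_pair_ne α
  -- the hypotheses as they are used, which survive composition with inner automorphisms
  let P : MulAut (FreeGroup α) → Prop := fun f => (∀ i, ∃ g, f (of i) = g * of i * g⁻¹) ∧
    ∀ i j, cyclicLength (f (of i) * f (of j)) ≤ 2
  have hPf : P f := by
    refine ⟨fun i => ?_, fun i j => ?_⟩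
    · obtain ⟨g, hg⟩ := isConj_iff.mp (hf (Sum.inl i))
      exact ⟨g, hg.symm⟩
    · have h := cyclicLength_eq_of_isConj (hf (Sum.inr (i, j)))
      rw [testWord] at h
      rw [← map_mul, ← h]
      exact (cyclicLength_le_norm _).trans ((FreeGroup.norm_mul_le _ _).trans (by simp))
  have hPc : ∀ f h, P f → P (MulAut.conj h * f) := by
    rintro f h ⟨h1, h2⟩
    refine ⟨fun i => ?_, fun i j => ?_⟩
    · obtain ⟨g, hg⟩ := h1 i
      exact ⟨h * g, by simp [hg, MulAut.conj_apply, mul_assoc]⟩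
    · rw [MulAut.mul_apply, MulAut.mul_apply, ← map_mul, MulAut.conj_apply, cyclicLength_conj]
      exact h2 i j
  have hPfix : ∀ f, P f → ∀ i j, f (of i) = of i →
      ∃ k : ℤ, f (of j) = of i ^ k * of j * (of i ^ k)⁻¹ := by
    rintro f ⟨h1, h2⟩ i j hi
    obtain ⟨g, hg⟩ := h1 j
    have h3 := h2 i j
    rw [hi, hg] at h3
    obtain ⟨k, m, rfl⟩ := eq_zpow_mul_zpow_of_cyclicLength_le g h3
    refine ⟨k, ?_⟩
    rw [hg, mul_inv_rev]
    have : of j ^ m * of j * (of j ^ m)⁻¹ = of j := by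
      rw [((Commute.refl (of j)).zpow_left m).eq, mul_inv_cancel_right]
    calc _ = of i ^ k * (of j ^ m * of j * (of j ^ m)⁻¹) * (of i ^ k)⁻¹ := by
          simp only [mul_assoc]
      _ = _ := by rw [this]
  obtain ⟨g, hg⟩ := hPf.1 a
  set f₁ := MulAut.conj g⁻¹ * f with hf₁
  have hP₁ : P f₁ := hPc _ _ hPf
  have h₁a : f₁ (of a) = of a := by simp [hf₁, hg, mul_assoc]
  obtain ⟨k, hk⟩ := hPfix f₁ hP₁ a b h₁a
  set f₂ := MulAut.conj (of a ^ k)⁻¹ * f₁ with hf₂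
  have hP₂ : P f₂ := hPc _ _ hP₁
  have h₂a : f₂ (of a) = of a := by
    rw [hf₂, MulAut.mul_apply, h₁a, MulAut.conj_apply, inv_inv,
      ← ((Commute.refl (of a)).zpow_left k).inv_left.eq.symm, inv_mul_cancel_right]
  have h₂b : f₂ (of b) = of b := by
    rw [hf₂, MulAut.mul_apply, hk, MulAut.conj_apply]
    simp [mul_assoc]
  have hone : f₂ = 1 := by
    apply MulEquiv.toMonoidHom_injective
    ext j
    change f₂ (of j) = of j
    by_cases hja : j = a
    · rw [hja, h₂a]
    by_cases hjb : j = b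
    · rw [hjb, h₂b]
    obtain ⟨k, hk⟩ := hPfix f₂ hP₂ a j h₂a
    obtain ⟨l, hl⟩ := hPfix f₂ hP₂ b j h₂b
    have : k = 0 := zpow_eq_zero_of_conj_eq (Ne.symm hja) hab.symm (Ne.symm hjb)
      (hk.symm.trans hl)
    rw [hk, this]
    simp
  refine ⟨g * of a ^ k, ?_⟩
  have h3 : f = MulAut.conj g * (MulAut.conj (of a ^ k) * f₂) := by
    rw [hf₂, hf₁]
    simp [← mul_assoc]
  rw [h3, hone, mul_one, map_mul]

variable [Fintype α]

theorem finite_conjLength_le (C : ℕ) : {c : ConjClasses (FreeGroup α) | conjLength c ≤ C}.Finite := by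
  refine ((finite_norm_le C).image ConjClasses.mk).subset fun c hc => ?_
  obtain ⟨g, rfl⟩ := ConjClasses.exists_rep c
  refine ⟨FreeGroup.mk (reduceCyclically g.toWord), norm_mk_le.trans hc, ?_⟩
  refine ConjClasses.mk_eq_mk_iff_isConj.mpr (isConj_iff.mpr
    ⟨FreeGroup.mk (reduceCyclically.conjugator g.toWord), ?_⟩)
  rw [inv_mk, mul_mk, mul_mk, reduceCyclically.conj_conjugator_reduceCyclically, mk_toWord]

/-- The list of test words. -/
noncomputable def testWords (α : Type*) [DecidableEq α] [Fintype α] : List (FreeGroup α) :=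
  (Finset.univ : Finset (α ⊕ α × α)).toList.map testWord

/-- The outer automorphisms that do not lengthen the list of test words. -/
def shortOuter (α : Type*) [DecidableEq α] [Fintype α] : Set (OutAut (FreeGroup α)) :=
  {θ | ∃ f : MulAut (FreeGroup α), QuotientGroup.mk f = θ ∧
    totalLength ((testWords α).map f) ≤ totalLength (testWords α)}

theorem finite_shortOuter [Nontrivial α] : (shortOuter α).Finite := by
  let Φ : OutAut (FreeGroup α) → (α ⊕ α × α → ConjClasses (FreeGroup α)) :=
    fun θ w => θ • ConjClasses.mk (testWord w)
  have hΦ : Function.Injective Φ := by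
    intro θ θ' h
    obtain ⟨f, rfl⟩ := QuotientGroup.mk_surjective θ
    obtain ⟨f', rfl⟩ := QuotientGroup.mk_surjective θ'
    refine QuotientGroup.eq.mpr (inner_of_isConj_testWord fun w => ?_)
    have h1 := congrFun h w
    simp only [Φ, outAut_mk_smul_mk] at h1
    have h2 := (f⁻¹ : MulAut (FreeGroup α)).toMonoidHom.map_isConj
      (ConjClasses.mk_eq_mk_iff_isConj.mp h1)
    have e : f⁻¹ (f (testWord w)) = testWord w := MulAut.inv_apply_self _ _ _
    change IsConj (f⁻¹ (f (testWord w))) ((f⁻¹ * f') (testWord w)) at h2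
    rwa [e] at h2
  refine Set.Finite.of_finite_image (f := Φ) ?_ hΦ.injOn
  refine (Set.Finite.pi' fun _ : α ⊕ α × α =>
    finite_conjLength_le (totalLength (testWords α))).subset ?_
  rintro _ ⟨_, ⟨f, rfl, hf⟩, rfl⟩ w
  refine le_trans ?_ hf
  refine List.single_le_sum (fun _ _ => Nat.zero_le _) _ (List.mem_map.mpr
    ⟨f (testWord w), List.mem_map.mpr ⟨testWord w, ?_, rfl⟩, rfl⟩)
  exact List.mem_map.mpr ⟨w, by simp, rfl⟩

end Whitehead

/-! ### Generating a stabilizer by short loops -/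

namespace Whitehead

open FreeGroup hiding map_mul map_one map_inv

/-- The group elements that are products of elements of `T` along which the point `c` stays in
`S`. -/
inductive Reachable {G X : Type*} [Group G] [MulAction G X] (T : Set G) (S : Set X) (c : X) :
    G → Prop
  | one : Reachable T S c 1
  | step {g τ : G} : Reachable T S c g → τ ∈ T → (τ * g) • c ∈ S → Reachable T S c (τ * g)

/-- If every element of the stabilizer of `c` is a product of elements of `T` along which `c` stays
in `S`, then the stabilizer is generated by the loops formed by a point of `S` and an element
of `T`, closed up along chosen paths from `c`. -/
theorem rank_stabilizer_le_of_reachable {G X : Type*} [Group G] [MulAction G X] (T : Finset G)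
    (S : Finset X) {c : X} (hc : c ∈ S)
    (h : ∀ g ∈ MulAction.stabilizer G c, Reachable (T : Set G) (S : Set X) c g) :
    ∃ _ : Group.FG (MulAction.stabilizer G c),
      Group.rank (MulAction.stabilizer G c) ≤ S.card * T.card := by
  classical
  have hex : ∀ x, ∃ t : G, x ∈ MulAction.orbit G c → t • c = x := by
    intro x
    by_cases hx : x ∈ MulAction.orbit G c
    · obtain ⟨t, ht⟩ := hx
      exact ⟨t, fun _ => ht⟩
    · exact ⟨1, fun hx' => absurd hx' hx⟩
  choose t ht using hex
  have ht' : ∀ g : G, t (g • c) • c = g • c := fun g => ht _ ⟨g, rfl⟩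
  have htc : t c • c = c := by simpa using ht' 1
  let loop : X × G → G := fun p => (t (p.2 • p.1))⁻¹ * p.2 * t p.1
  let gen : X × G → MulAction.stabilizer G c := fun p =>
    if hp : loop p ∈ MulAction.stabilizer G c then ⟨loop p, hp⟩ else 1
  let gens := (S ×ˢ T).image gen
  have key : ∀ g, Reachable (T : Set G) (S : Set X) c g →
      g • c ∈ S ∧ ∃ k ∈ Subgroup.closure (gens : Set (MulAction.stabilizer G c)),
        (k : G) = (t (g • c))⁻¹ * g * t c := by
    intro g hg
    induction hg with
    | one => exact ⟨by simpa using hc, 1, one_mem _, by simp⟩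
    | @step g τ _ hτ hmem ih =>
      obtain ⟨hgS, k, hk, hk'⟩ := ih
      refine ⟨hmem, gen (g • c, τ) * k, mul_mem (Subgroup.subset_closure ?_) hk, ?_⟩
      · exact Finset.mem_coe.mpr (Finset.mem_image_of_mem _ (Finset.mk_mem_product hgS hτ))
      · have hp : loop (g • c, τ) ∈ MulAction.stabilizer G c := by
          simp only [loop, MulAction.mem_stabilizer_iff, mul_smul, ht', inv_smul_eq_iff]
          rw [← mul_smul, ht']
        simp only [gen, dif_pos hp, Subgroup.coe_mul, hk', loop, ← mul_smul]
        group
  have htop : Subgroup.closure (gens : Set (MulAction.stabilizer G c)) = ⊤ := by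
    refine eq_top_iff.mpr fun g _ => ?_
    have hg : t c * g * (t c)⁻¹ ∈ MulAction.stabilizer G c := by
      have h1 : t c ∈ MulAction.stabilizer G c := htc
      exact mul_mem (mul_mem h1 g.2) (inv_mem h1)
    obtain ⟨-, k, hk, hk'⟩ := key _ (h _ hg)
    rw [MulAction.mem_stabilizer_iff.mp hg] at hk'
    have : k = g := Subtype.ext (by rw [hk']; group)
    exact this ▸ hk
  refine ⟨⟨⟨gens, htop⟩⟩, ?_⟩
  have := (⟨⟨gens, htop⟩⟩ : Group.FG (MulAction.stabilizer G c))
  exact (Group.rank_le htop).trans (Finset.card_image_le.trans_eq (Finset.card_product _ _))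

/-! ### Minimal conjugacy classes -/

variable {α : Type*} [DecidableEq α] [Fintype α]

/-- The outer classes of Whitehead automorphisms together with the inverses of the outer
automorphisms that keep the test words short. -/
def basicOuter (α : Type*) [DecidableEq α] [Fintype α] : Set (OutAut (FreeGroup α)) :=
  Set.range (fun p : Finset (α × Bool) × (α × Bool) => QuotientGroup.mk (whitehead p.1 p.2)) ∪
    (shortOuter α)⁻¹

theorem finite_basicOuter [Nontrivial α] : (basicOuter α).Finite :=
  (Set.finite_range _).union finite_shortOuter.inv

/-- Any two minimal elements of an orbit are connected, through any given automorphism between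
them, by a chain of basic moves through minimal elements. -/
theorem reachable_of_minimal {u : FreeGroup α}
    (hu : ∀ f : MulAut (FreeGroup α), cyclicLength u ≤ cyclicLength (f u))
    {S : Set (ConjClasses (FreeGroup α))}
    (hS : ∀ f : MulAut (FreeGroup α), cyclicLength (f u) = cyclicLength u →
      ConjClasses.mk (f u) ∈ S)
    {φ : MulAut (FreeGroup α)} (hφ : cyclicLength (φ u) = cyclicLength u) :
    Reachable (basicOuter α) S (ConjClasses.mk u) (QuotientGroup.mk φ) := by
  suffices H : ∀ n, ∀ ψ : MulAut (FreeGroup α), cyclicLength (ψ u) = cyclicLength u →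
      totalLength ((testWords α).map (ψ * φ⁻¹)) = n →
      Reachable (basicOuter α) S (ConjClasses.mk u) (QuotientGroup.mk ψ) →
      Reachable (basicOuter α) S (ConjClasses.mk u) (QuotientGroup.mk φ) from
    H _ 1 rfl rfl Reachable.one
  intro n
  induction n using Nat.strong_induction_on with
  | _ n ih =>
  intro ψ hψ hn hreach
  -- so many copies of `ψ u` that a shorter test list cannot pay for lengthening it
  set U := List.replicate n (ψ u) ++ (testWords α).map (ψ * φ⁻¹) with hU
  have htot : ∀ f : MulAut (FreeGroup α), totalLength (U.map f) =
      n * cyclicLength (f (ψ u)) + totalLength ((testWords α).map (f * ψ * φ⁻¹)) := by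
    intro f
    simp only [hU, totalLength, List.map_append, List.map_replicate, List.sum_append,
      List.sum_replicate, smul_eq_mul, List.map_map]
    rfl
  have htot1 : totalLength U = n * cyclicLength u + n := by
    have := htot 1
    simpa only [MulAut.one_apply, hψ, one_mul, hn, MulAut.coe_one, List.map_id] using this
  by_cases hmin : WhiteheadMinimal U
  · have h1 := hmin.totalLength_le (φ * ψ⁻¹)
    have e : φ * ψ⁻¹ * ψ * φ⁻¹ = 1 := by group
    rw [htot1, htot, e, MulAut.mul_apply, MulAut.inv_apply_self, hφ, MulAut.coe_one,
      List.map_id] at h1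
    have hmem : (QuotientGroup.mk (φ * ψ⁻¹) : OutAut (FreeGroup α)) ∈ basicOuter α := by
      refine Or.inr (Set.mem_inv.mpr ⟨ψ * φ⁻¹, ?_, by omega⟩)
      rw [← QuotientGroup.mk_inv, mul_inv_rev, inv_inv]
    have e2 : (QuotientGroup.mk (φ * ψ⁻¹) : OutAut (FreeGroup α)) * QuotientGroup.mk ψ =
        QuotientGroup.mk φ := by
      rw [← QuotientGroup.mk_mul, inv_mul_cancel_right]
    rw [← e2]
    refine hreach.step hmem ?_
    rw [e2, outAut_mk_smul_mk]
    exact hS φ hφ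
  · simp only [WhiteheadMinimal, not_forall, not_le] at hmin
    obtain ⟨A, c, -, -, hlt⟩ := hmin
    set f := whitehead A c with hf
    rw [htot1, htot] at hlt
    have h1 := hu (f * ψ)
    rw [MulAut.mul_apply] at h1
    have h2 : cyclicLength (f (ψ u)) = cyclicLength u := by
      by_contra hne
      have h3 : cyclicLength u + 1 ≤ cyclicLength (f (ψ u)) := by omega
      have h4 := Nat.mul_le_mul_left n h3
      rw [mul_add, mul_one] at h4
      omega
    rw [h2] at hlt
    refine ih _ (by omega) (f * ψ) h2 rfl ?_
    rw [QuotientGroup.mk_mul]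
    refine hreach.step (Or.inl ⟨(A, c), rfl⟩) ?_
    rw [← QuotientGroup.mk_mul, outAut_mk_smul_mk]
    exact hS _ h2

/-- A minimizing set contains every element of its orbit that is no longer than some member. -/
theorem mem_of_isMinimizingSet {N M : ℕ} {lam ε : ℝ} (hlam : 1 < lam)
    {S : Finset (ConjClasses (FreeGroup (Fin N)))} (hS : IsMinimizingSet M lam ε S)
    {c : ConjClasses (FreeGroup (Fin N))} (hc : c ∈ S) {φ : OutAut (FreeGroup (Fin N))}
    (hle : conjLength (φ • c) ≤ conjLength c) : φ • c ∈ S := by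
  by_contra hn
  have h1 := hS.le_ratio c hc φ hn
  have h2 : (conjLength (φ • c) : ℝ) / conjLength c ≤ 1 :=
    div_le_one_of_le₀ (by exact_mod_cast hle) (Nat.cast_nonneg _)
  linarith

end Whitehead

open Whitehead in
theorem mainTheorem10 :
    ∃ K : ℕ → ℕ → ℕ, ∀ N : ℕ, 2 ≤ N → ∀ M : ℕ, 1 ≤ M →
      ∀ lam ε : ℝ, 1 < lam → 0 ≤ ε → ε < lam - 1 →
        ∀ u : FreeGroup (Fin N), u ≠ 1 →
          (∃ c ∈ MulAction.orbit (OutAut (FreeGroup (Fin N))) (ConjClasses.mk u),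
            IsMLEMinimal M lam ε c) →
          ∃ _ : Group.FG
              (MulAction.stabilizer (OutAut (FreeGroup (Fin N))) (ConjClasses.mk u)),
            Group.rank
              (MulAction.stabilizer (OutAut (FreeGroup (Fin N))) (ConjClasses.mk u)) ≤ K N M := by
  refine ⟨fun N M => M * (basicOuter (Fin N)).ncard, ?_⟩
  rintro N hN M - lam ε hlam - - u - ⟨c, hcu, S, hS, hcS⟩
  have : Nontrivial (Fin N) := Fin.nontrivial_iff_two_le.mpr hN
  obtain ⟨c₀, hc₀, hmin⟩ := (measure (conjLength (α := Fin N))).wf.has_min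
    (MulAction.orbit (OutAut (FreeGroup (Fin N))) c) ⟨c, MulAction.mem_orbit_self c⟩
  have hmin' : ∀ φ : OutAut (FreeGroup (Fin N)), conjLength c₀ ≤ conjLength (φ • c₀) := by
    obtain ⟨g, rfl⟩ := hc₀
    intro φ
    exact not_lt.mp (hmin _ ⟨φ * g, mul_smul φ g c⟩)
  -- every minimal element of the orbit lies in the minimizing set
  have hmem : ∀ φ : OutAut (FreeGroup (Fin N)), conjLength (φ • c₀) = conjLength c₀ →
      φ • c₀ ∈ S := by
    intro φ hφ
    obtain ⟨g, hg⟩ := hc₀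
    have hg : g • c = c₀ := hg
    rw [← hg, ← mul_smul]
    refine mem_of_isMinimizingSet hlam hS hcS ?_
    rw [mul_smul, hg, hφ]
    have := hmin' g⁻¹
    rwa [← hg, inv_smul_smul, hg] at this
  obtain ⟨v, rfl⟩ := ConjClasses.exists_rep c₀
  obtain ⟨hfg, hrank⟩ := rank_stabilizer_le_of_reachable
    (finite_basicOuter (α := Fin N)).toFinset S (c := ConjClasses.mk v)
    (by simpa using hmem 1 (by simp)) (by
      intro φ hφ
      obtain ⟨f, rfl⟩ := QuotientGroup.mk_surjective φ
      rw [Set.Finite.coe_toFinset]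
      exact reachable_of_minimal (fun f => hmin' (QuotientGroup.mk f))
        (fun f hf => hmem (QuotientGroup.mk f) hf)
        (congrArg conjLength (MulAction.mem_stabilizer_iff.mp hφ)))
  obtain ⟨g, hg⟩ : ConjClasses.mk u ∈
      MulAction.orbit (OutAut (FreeGroup (Fin N))) (ConjClasses.mk v) := by
    rw [MulAction.orbit_eq_iff.mpr hc₀, MulAction.orbit_eq_iff.mpr hcu]
    exact MulAction.mem_orbit_self _
  let e := MulAction.stabilizerEquivStabilizer (G := OutAut (FreeGroup (Fin N))) hg.symm
  have hfg' := Group.fg_of_surjective (f := e.toMonoidHom) e.surjective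
  refine ⟨hfg', (Group.rank_congr e).symm.le.trans (hrank.trans ?_)⟩
  rw [← Set.ncard_eq_toFinset_card _ finite_basicOuter]
  exact Nat.mul_le_mul_right _ hS.card_le
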